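/- Let $\Omega\subset\mathbb{R}^2$ be convex and compact, and let $X:=\Omega\cap\mathbb{Z}^2$. A vector $e=(\alpha,\beta)\in\mathbb{Z}^2$ is irreducible if $\gcd(\alpha,\beta)=1$. Every irreducible $e$ with Euclidean norm $\|e\|>1$ can be written in exactly one way as $e=f+g$ with $f,g\in\mathbb{Z}^2$, $\det(f,g)=1$ and $\langle f,g\rangle\ge 0$; the vectors $f,g$ are the parents of $e$ (unit vectors have no parents). For $x\in X$ put $\mathcal{V}_{\max}(x):=\{e\in\mathbb{Z}^2 \text{ irreducible}: x+e\in X\}$. Denote by $\mathrm{Cone}(A)$ the convex cone generated by $A\subset\mathbb{R}^2$, with $\mathrm{Cone}(\emptyset)=\{0\}$. A family of stencils on $X$ is a collection $\mathcal{V}=(\mathcal{V}(x))_{x\in X}$ of sets $\mathcal{V}(x)\subset\mathcal{V}_{\max}(x)$ such that, for every $x\in X$: (Stability) any parent $f\in\mathcal{V}_{\max}(x)$ of any $e\in\mathcal{V}(x)$ belongs to $\mathcal{V}(x)$; (Visibility) $\mathrm{Cone}(\mathcal{V}(x))=\mathrm{Cone}(\mathcal{V}_{\max}(x))$. Let $\hat{\mathcal{V}}(x)$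 be the set of all $e\in\mathcal{V}_{\max}(x)\setminus\mathcal{V}(x)$ that have two parents, both in $\mathcal{V}(x)$. Unions, intersections and inclusions of families are taken pointwise in $x$. Let $\mathrm{Conv}(X)$ be the set of restrictions to $X$ of convex functions $\Omega\to\mathbb{R}$, and let $\mathrm{Conv}(\mathcal{V})$ be the set of all $u:X\to\mathbb{R}$ such that, for all $x\in X$: 1. $u(x+e)-2u(x)+u(x-e)\ge 0$ for all $e\in\mathcal{V}(x)$ with $x-e\in X$; 2. $u(x+e)+u(x-f)+u(x-g)-3u(x)\ge 0$ for all $e\in\mathcal{V}(x)$ with $\|e\|>1$, of parents $f,g$, such that $x-f,\,x-g\in X$; 3. $u(x+e)-u(x+f)-u(x+g)+u(x)\ge 0$ for all $e\in\hat{\mathcal{V}}(x)$, of parents $f,g$. **Theorem (Hierarchy).** Let $\mathcal{V},\mathcal{V}'$ be two families of stencils on $X$. Then $\mathcal{V}\cup\mathcal{V}'$ and $\mathcal{V}\cap\mathcal{V}'$ are also families of stencils on $X$, and $$\mathrm{Conv}(\mathcal{V})\cap\mathrm{Conv}(\mathcal{V}')=\mathrm{Conv}(\mathcal{V}\cap\mathcal{V}'),\qquad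 \mathrm{Conv}(\mathcal{V})\cup\mathrm{Conv}(\mathcal{V}')\subset\mathrm{Conv}(\mathcal{V}\cup\mathcal{V}').$$ As a result, if $\mathcal{V}\subset\mathcal{V}'$, then $\mathrm{Conv}(\mathcal{V})\subset\mathrm{Conv}(\mathcal{V}')\subset\mathrm{Conv}(X)$. -/

import Mathlib

namespace StencilCone

/-- The embedding of the lattice `ℤ²` into the plane `ℝ²`. The plane is modelled by `ℝ × ℝ`:
only its vector space structure and its topology are used, and Euclidean lengths of lattice
vectors are written out in coordinates. -/
def toPlane (p : ℤ × ℤ) : ℝ × ℝ := ((p.1 : ℝ), (p.2 : ℝ))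

/-- The discrete domain `X = Ω ∩ ℤ²`. -/
def grid (Ω : Set (ℝ × ℝ)) : Set (ℤ × ℤ) := {p | toPlane p ∈ Ω}

/-- The determinant of a pair of lattice vectors. -/
def det (f g : ℤ × ℤ) : ℤ := f.1 * g.2 - f.2 * g.1

/-- The Euclidean inner product of two lattice vectors. -/
def dot (f g : ℤ × ℤ) : ℤ := f.1 * g.1 + f.2 * g.2

/-- A lattice vector is irreducible if its coordinates are coprime. -/
def Irred (e : ℤ × ℤ) : Prop := Int.gcd e.1 e.2 = 1

/-- `f, g` are the parents of `e`: `(f, g)` is a direct acute basis of `ℤ²` and `e = f + g`. -/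
structure AreParents (f g e : ℤ × ℤ) : Prop where
  direct : det f g = 1
  acute : 0 ≤ dot f g
  sum : e = f + g

/-- `f` is one of the two parents of `e`. -/
def IsParent (f e : ℤ × ℤ) : Prop := ∃ g, AreParents f g e ∨ AreParents g f e

variable {Ω : Set (ℝ × ℝ)}

/-- The maximal stencil at `x ∈ X`: the irreducible `e` with `x + e ∈ X`. -/
def maxStencil (x : grid Ω) : Set (ℤ × ℤ) := {e | Irred e ∧ (x : ℤ × ℤ) + e ∈ grid Ω}

/-- The convex cone in the plane generated by a set of lattice vectors
(it is `{0}` for the empty set). -/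
def coneHull (A : Set (ℤ × ℤ)) : PointedCone ℝ (ℝ × ℝ) := PointedCone.hull ℝ (toPlane '' A)

/-- Families of stencils on `X = Ω ∩ ℤ²`. -/
structure IsStencilFamily (V : grid Ω → Set (ℤ × ℤ)) : Prop where
  subset_max : ∀ x, V x ⊆ maxStencil x
  stability : ∀ x, ∀ e ∈ V x, ∀ f ∈ maxStencil x, IsParent f e → f ∈ V x
  visibility : ∀ x, coneHull (V x) = coneHull (maxStencil x)

/-- Candidates for refinement at `x`: the elements of the maximal stencil outside `V x`
which have two parents, both in `V x`. -/
def candidates (V : grid Ω → Set (ℤ × ℤ)) (x : grid Ω) : Set (ℤ × ℤ) :=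
  {e | e ∈ maxStencil x ∧ e ∉ V x ∧ ∃ f g, AreParents f g e ∧ f ∈ V x ∧ g ∈ V x}

/-- The cone `Conv(V)` of all `u : X → ℝ` on which the segment forms `S_x^e`, the triangle forms
`T_x^e` (both for `e ∈ V x`, whenever supported in `X`) and the parallelogram forms `P_x^e`
(for candidates `e`; these are always supported in `X`) are non-negative. -/
structure MemStencilCone (V : grid Ω → Set (ℤ × ℤ)) (u : grid Ω → ℝ) : Prop where
  segment : ∀ x : grid Ω, ∀ e ∈ V x,
    ∀ (hp : (x : ℤ × ℤ) + e ∈ grid Ω) (hm : (x : ℤ × ℤ) - e ∈ grid Ω),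
      0 ≤ u ⟨x + e, hp⟩ - 2 * u x + u ⟨x - e, hm⟩
  triangle : ∀ x : grid Ω, ∀ e ∈ V x, 1 < dot e e → ∀ f g : ℤ × ℤ, AreParents f g e →
    ∀ (he : (x : ℤ × ℤ) + e ∈ grid Ω) (hf : (x : ℤ × ℤ) - f ∈ grid Ω)
      (hg : (x : ℤ × ℤ) - g ∈ grid Ω),
      0 ≤ u ⟨x + e, he⟩ + u ⟨x - f, hf⟩ + u ⟨x - g, hg⟩ - 3 * u x
  parallelogram : ∀ x : grid Ω, ∀ e ∈ candidates V x, ∀ f g : ℤ × ℤ, AreParents f g e →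
    ∀ (he : (x : ℤ × ℤ) + e ∈ grid Ω) (hf : (x : ℤ × ℤ) + f ∈ grid Ω)
      (hg : (x : ℤ × ℤ) + g ∈ grid Ω),
      0 ≤ u ⟨x + e, he⟩ - u ⟨x + f, hf⟩ - u ⟨x + g, hg⟩ + u x

/-- The cone `Conv(V)`, as a subset of the space of functions on `X`. -/
def stencilCone (V : grid Ω → Set (ℤ × ℤ)) : Set (grid Ω → ℝ) := {u | MemStencilCone V u}

/-- `Conv(X)`: the restrictions to `X = Ω ∩ ℤ²` of the convex functions on `Ω`. -/
def convexCone (Ω : Set (ℝ × ℝ)) : Set (grid Ω → ℝ) :=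
  {u | ∃ U : ℝ × ℝ → ℝ, ConvexOn ℝ Ω U ∧ ∀ x : grid Ω, u x = U (toPlane x)}

end StencilCone

/-! The lever is `forms_nonneg`: if u lies in Conv(V), then u satisfies every segment and triangle
inequality of the maximal stencils, and the parallelogram inequality of every vector missing from V,
not only of the candidates. Enlarging V then imposes nothing new on u, which is
`MemStencilCone.mono`. The equality for intersections follows from monotonicity together with the
remark that a candidate for V ∩ V' is a candidate for whichever family lacks it.

To get the lever, take e missing from V(x). Visibility surrounds e by two elements of V(x),
Stability allows a descent through parents to a direct acute basis still surrounding e, and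
Stern–Brocot subdivision leads to a basis (p, q) in V(x) with p + q a candidate and e = ap + bq, a,
b > 0 (`exists_candidate`). The parallelogram inequality at p + q is then carried down the tree to
e; each step costs one segment inequality for a vector shorter than e, so a strong induction on ‖e‖²
closes the loop. Since p and q are shorter than e, `exists_candidate` also gives Visibility of V ∩
V'.

For the inclusion in Conv(X), the segment and triangle inequalities suffice. They make u convex on
every lattice triangle (`defect_nonpos`): in a violating triangle of least area, a worst point is
the only lattice point besides the vertices, hence the midpoint of a side or the centroid, which is
what the two kinds of forms test. Helly's theorem turns this into a supporting affine function at
each point (`exists_support`), and the maximum of these finitely many functions is a convex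
extension. -/

namespace StencilCone

/-! ### Lattice arithmetic: existence and uniqueness of parents. -/

section

theorem irred_iff_isCoprime {e : ℤ × ℤ} : Irred e ↔ IsCoprime e.1 e.2 :=
  Int.isCoprime_iff_gcd_eq_one.symm

theorem irred_left_of_det_eq_one {f g : ℤ × ℤ} (h : det f g = 1) : Irred f := by
  rw [irred_iff_isCoprime]
  exact ⟨g.2, -g.1, by simp only [det] at h; linarith⟩

theorem irred_right_of_det_eq_one {f g : ℤ × ℤ} (h : det f g = 1) : Irred g := by
  rw [irred_iff_isCoprime]
  exact ⟨-f.2, f.1, by simp only [det] at h; linarith⟩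

theorem Irred.neg {e : ℤ × ℤ} (h : Irred e) : Irred (-e) := by
  simpa [Irred] using h

theorem AreParents.neg {f g e : ℤ × ℤ} (h : AreParents f g e) : AreParents (-f) (-g) (-e) where
  direct := by have := h.direct; simp only [det, Prod.fst_neg, Prod.snd_neg] at *; linarith
  acute := by have := h.acute; simp only [dot, Prod.fst_neg, Prod.snd_neg] at *; linarith
  sum := by rw [h.sum, neg_add]

theorem AreParents.det_left {f g e : ℤ × ℤ} (h : AreParents f g e) : det f e = 1 := by
  have := h.direct
  simp only [h.sum, det, Prod.fst_add, Prod.snd_add] at *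
  linarith

theorem AreParents.det_right {f g e : ℤ × ℤ} (h : AreParents f g e) : det e g = 1 := by
  have := h.direct
  simp only [h.sum, det, Prod.fst_add, Prod.snd_add] at *
  linarith

theorem AreParents.irred {f g e : ℤ × ℤ} (h : AreParents f g e) : Irred e :=
  irred_left_of_det_eq_one h.det_right

theorem dot_self_nonneg (e : ℤ × ℤ) : 0 ≤ dot e e := by
  simp only [dot]; nlinarith [sq_nonneg e.1, sq_nonneg e.2]

theorem dot_self_pos {e : ℤ × ℤ} (h : e ≠ 0) : 0 < dot e e := by
  rcases (dot_self_nonneg e).lt_or_eq with h1 | h1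
  · exact h1
  · exfalso
    apply h
    simp only [dot] at h1
    have h2 : e.1 = 0 := by nlinarith [sq_nonneg e.1, sq_nonneg e.2]
    have h3 : e.2 = 0 := by nlinarith [sq_nonneg e.1, sq_nonneg e.2]
    exact Prod.ext h2 h3

theorem Irred.ne_zero {e : ℤ × ℤ} (h : Irred e) : e ≠ 0 := by
  rintro rfl
  simp [Irred] at h

theorem Irred.dot_self_pos {e : ℤ × ℤ} (h : Irred e) : 0 < dot e e :=
  StencilCone.dot_self_pos h.ne_zero

theorem lagrange_identity (f g : ℤ × ℤ) : dot f f * dot g g = dot f g ^ 2 + det f g ^ 2 := by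
  simp only [dot, det]; ring

theorem Irred.eq_smul_of_det_eq_zero {e f : ℤ × ℤ} (he : Irred e) (h : det e f = 0) :
    ∃ k : ℤ, f = k • e := by
  obtain ⟨a, b, hab⟩ := irred_iff_isCoprime.1 he
  simp only [det] at h
  refine ⟨a * f.1 + b * f.2, Prod.ext ?_ ?_⟩ <;>
    simp only [Prod.smul_fst, Prod.smul_snd, smul_eq_mul]
  · linear_combination (-f.1) * hab - b * h
  · linear_combination (-f.2) * hab + a * h

theorem Irred.eq_or_eq_neg {e f : ℤ × ℤ} (he : Irred e) (hf : Irred f) (h : det e f = 0) :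
    f = e ∨ f = -e := by
  obtain ⟨c, d, hcd⟩ := irred_iff_isCoprime.1 hf
  obtain ⟨k, rfl⟩ := he.eq_smul_of_det_eq_zero h
  simp only [Prod.smul_fst, Prod.smul_snd, smul_eq_mul] at hcd
  have hk : k * (c * e.1 + d * e.2) = 1 := by linear_combination hcd
  rcases Int.eq_one_or_neg_one_of_mul_eq_one hk with rfl | rfl
  · left; rw [one_smul]
  · right; rw [neg_smul, one_smul]

theorem exists_irred_smul {v : ℤ × ℤ} (hv : v ≠ 0) :
    ∃ (d : ℤ) (e : ℤ × ℤ), 0 < d ∧ Irred e ∧ v = d • e := by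
  have h0 : 0 < Int.gcd v.1 v.2 := by
    rw [Int.gcd_pos_iff]
    by_contra! h
    exact hv (Prod.ext h.1 h.2)
  obtain ⟨a, b, h1, h2, h3⟩ := Int.exists_gcd_one h0
  refine ⟨Int.gcd v.1 v.2, (a, b), by exact_mod_cast h0, h1, Prod.ext ?_ ?_⟩
  · simpa [mul_comm] using h2
  · simpa [mul_comm] using h3

/-- Cramer's rule in a direct basis of the lattice. -/
theorem eq_combination_of_det_eq_one {p q : ℤ × ℤ} (h : det p q = 1) (e : ℤ × ℤ) :
    e = det e q • p + det p e • q := by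
  simp only [det] at h
  ext <;> simp only [det, Prod.fst_add, Prod.snd_add, Prod.smul_fst, Prod.smul_snd, smul_eq_mul]
  · linear_combination (-e.1) * h
  · linear_combination (-e.2) * h

/-- A Bézout vector has determinant 1 with e; translating it by multiples of e reduces s = ⟨f, e⟩
modulo n = ‖e‖². Lagrange's identity then reads tn = s² + 1 with t = ‖f‖², and 0 ≤ s < n, n > 1
force t ≤ s, that is ⟨f, e - f⟩ ≥ 0. -/
theorem exists_areParents {e : ℤ × ℤ} (he : Irred e) (h1 : 1 < dot e e) :
    ∃ f g, AreParents f g e := by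
  obtain ⟨a, b, hab⟩ := irred_iff_isCoprime.1 he
  set k := dot (b, -a) e / dot e e with hk
  set f : ℤ × ℤ := (b, -a) - k • e with hf
  have hdet : det f e = 1 := by
    simp only [hf, det, Prod.fst_sub, Prod.snd_sub, Prod.smul_fst, Prod.smul_snd, smul_eq_mul]
    linear_combination hab
  have hdot : dot f e = dot (b, -a) e % dot e e := by
    rw [Int.emod_def, ← hk]
    simp only [hf, dot, Prod.fst_sub, Prod.snd_sub, Prod.smul_fst, Prod.smul_snd, smul_eq_mul]
    ring
  have h0 : 0 ≤ dot f e := hdot ▸ Int.emod_nonneg _ (by omega)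
  have h2 : dot f e < dot e e := hdot ▸ Int.emod_lt_of_pos _ (by omega)
  have hl := lagrange_identity f e
  rw [hdet] at hl
  refine ⟨f, e - f, ⟨?_, ?_, by abel⟩⟩
  · simp only [det, Prod.fst_sub, Prod.snd_sub] at hdet ⊢
    linarith
  · have h3 : dot f (e - f) = dot f e - dot f f := by
      simp only [dot, Prod.fst_sub, Prod.snd_sub]; ring
    rw [h3]
    generalize dot f e = s at *
    generalize dot e e = n at *
    generalize dot f f = t at *
    rcases h0.eq_or_lt with rfl | h0
    · have : n = 1 := Int.eq_one_of_dvd_one (by omega) ⟨t, by linarith⟩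
      omega
    · by_contra hlt
      have : s + 1 ≤ t := by omega
      nlinarith [mul_pos h0 (sub_pos.2 h2)]

/-- Since det(f, e) = det(f', e) = 1, f' = f + ke and g' = g - ke. Expanding, ⟨f', g'⟩ = (1 -
2k²)⟨f, g⟩ + (k - k²)‖g‖² - (k + k²)‖f‖², which is negative for every nonzero integer k. -/
theorem AreParents.unique {f g f' g' e : ℤ × ℤ} (h : AreParents f g e) (h' : AreParents f' g' e) :
    f' = f ∧ g' = g := by
  have key : f' = f := by
    have hc := eq_combination_of_det_eq_one h.det_left f'
    rw [h'.det_left, one_smul] at hc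
    set k := det f f'
    have hg : g' = g - k • e := by
      have h1 := h'.sum
      have h2 := h.sum
      have : g' = e - f' := by rw [h1]; abel
      rw [this, hc]; nth_rewrite 1 [h2]; abel
    have hd : dot f' g' = dot f g + k * dot g e - k * dot f e - k ^ 2 * dot e e := by
      rw [hg, hc]
      simp only [dot, Prod.fst_add, Prod.snd_add, Prod.fst_sub, Prod.snd_sub, Prod.smul_fst,
        Prod.smul_snd, smul_eq_mul]
      ring
    have hF := (irred_left_of_det_eq_one h.direct).dot_self_pos
    have hG := (irred_right_of_det_eq_one h.direct).dot_self_pos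
    have hH := h.acute
    have hge : dot g e = dot f g + dot g g := by
      rw [h.sum]; simp only [dot, Prod.fst_add, Prod.snd_add]; ring
    have hfe : dot f e = dot f f + dot f g := by
      rw [h.sum]; simp only [dot, Prod.fst_add, Prod.snd_add]; ring
    have hee : dot e e = dot f f + 2 * dot f g + dot g g := by
      rw [h.sum]; simp only [dot, Prod.fst_add, Prod.snd_add]; ring
    have hlag := lagrange_identity f g
    have hpos := h'.acute
    rw [hd, hge, hfe, hee] at hpos
    rw [h.direct] at hlag
    generalize dot f f = F at *
    generalize dot g g = G at *
    generalize dot f g = H at *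
    have hk0 : k = 0 := by
      by_contra hk
      rcases lt_or_gt_of_ne hk with hk | hk
      · nlinarith [mul_nonneg (mul_nonneg_of_nonpos_of_nonpos hk.le (by omega : k + 1 ≤ 0)) hF.le,
          mul_pos (mul_pos_of_neg_of_neg hk (by omega : k - 1 < 0)) hG,
          mul_nonneg (by nlinarith : 0 ≤ k ^ 2 - 1) hH]
      · nlinarith [mul_nonneg (mul_nonneg hk.le (by omega : 0 ≤ k - 1)) hG.le,
          mul_pos (mul_pos hk (by omega : 0 < k + 1)) hF,
          mul_nonneg (by nlinarith : 0 ≤ k ^ 2 - 1) hH]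
    rw [hc, hk0, zero_smul, add_zero]
  refine ⟨key, ?_⟩
  have := h.sum.symm.trans h'.sum
  rw [key] at this
  exact (add_left_cancel this).symm

end

/-! ### Lattice convexity and the descent through parents. -/

section

/-- A set of lattice points containing the lattice points of all triangles with vertices in it. -/
def LatticeConvex (G : Set (ℤ × ℤ)) : Prop :=
  ∀ a ∈ G, ∀ b ∈ G, ∀ c ∈ G, ∀ n i j : ℤ, 0 < n → 0 ≤ i → 0 ≤ j → i + j ≤ n →
    ∀ p : ℤ × ℤ, n • (p - a) = i • (b - a) + j • (c - a) → p ∈ G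

theorem latticeConvex_grid {Ω : Set (ℝ × ℝ)} (h : Convex ℝ Ω) : LatticeConvex (grid Ω) := by
  intro a ha b hb c hc n i j hn hi hj hij p hp
  have hn' : (0 : ℝ) < n := by exact_mod_cast hn
  have hi' : (0 : ℝ) ≤ i := by exact_mod_cast hi
  have hj' : (0 : ℝ) ≤ j := by exact_mod_cast hj
  have hij' : (i : ℝ) + j ≤ n := by exact_mod_cast hij
  have h1 := congrArg Prod.fst hp
  have h2 := congrArg Prod.snd hp
  simp only [Prod.smul_fst, Prod.fst_sub, Prod.fst_add, smul_eq_mul, Prod.smul_snd, Prod.snd_sub,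
    Prod.snd_add] at h1 h2
  have h1' : (n : ℝ) * (p.1 - a.1) = i * (b.1 - a.1) + j * (c.1 - a.1) := by exact_mod_cast h1
  have h2' : (n : ℝ) * (p.2 - a.2) = i * (b.2 - a.2) + j * (c.2 - a.2) := by exact_mod_cast h2
  have key : toPlane p = ((n - i - j : ℝ) / n) • toPlane a + ((i : ℝ) / n) • toPlane b
      + ((j : ℝ) / n) • toPlane c := by
    ext <;> simp only [toPlane, Prod.fst_add, Prod.snd_add, Prod.smul_fst, Prod.smul_snd,
      smul_eq_mul] <;> field_simp
    · linear_combination h1'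
    · linear_combination h2'
  change toPlane p ∈ Ω
  rw [key]
  have hs := h.sum_mem (t := Finset.univ) (w := ![(n - i - j : ℝ) / n, (i : ℝ) / n, (j : ℝ) / n])
    (z := ![toPlane a, toPlane b, toPlane c]) ?_ ?_ ?_
  · simpa [Fin.sum_univ_three] using hs
  · intro k _
    fin_cases k
    · exact div_nonneg (by linarith) hn'.le
    · exact div_nonneg hi' hn'.le
    · exact div_nonneg hj' hn'.le
  · simp only [Fin.sum_univ_three, Matrix.cons_val]
    field_simp
    ring
  · intro k _
    fin_cases k
    · exact ha
    · exact hb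
    · exact hc

variable {G : Set (ℤ × ℤ)} {x : ℤ × ℤ}

theorem LatticeConvex.add_mem (hG : LatticeConvex G) (hx : x ∈ G) {v w p : ℤ × ℤ}
    (hv : x + v ∈ G) (hw : x + w ∈ G) {n i j : ℤ} (hn : 0 < n) (hi : 0 ≤ i) (hj : 0 ≤ j)
    (hij : i + j ≤ n) (hp : n • p = i • v + j • w) : x + p ∈ G :=
  hG x hx _ hv _ hw n i j hn hi hj hij _ (by simpa using hp)

/-- If a ≤ b, then b(p + q) = e + (b - a)p, so p + q lies in the triangle 0, e, p; symmetrically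
otherwise. -/
theorem LatticeConvex.add_add_mem (hG : LatticeConvex G) (hx : x ∈ G) {p q e : ℤ × ℤ} {a b : ℤ}
    (ha : 0 < a) (hb : 0 < b) (he : e = a • p + b • q)
    (hp : x + p ∈ G) (hq : x + q ∈ G) (hxe : x + e ∈ G) : x + (p + q) ∈ G := by
  rcases le_total a b with hab | hab
  · refine hG.add_mem hx hxe hp (n := b) (i := 1) (j := b - a) hb (by omega) (by omega) (by omega) ?_
    rw [he]; module
  · refine hG.add_mem hx hxe hq (n := a) (i := 1) (j := a - b) ha (by omega) (by omega) (by omega) ?_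
    rw [he]; module

/-- With m = det(v, w) and n = det(v, f), one has mf = v + nw, so f lies in the triangle 0, v, w
once 0 ≤ n < m. In the acute basis, v = (m - n)f - ng, and n < 0 or n > m would make v longer than
w. In the remaining case n = m, v = -mg is irreducible, so m = 1 and f = v + w; only there is the
vector e between v and w needed. -/
theorem parent_left_mem (hG : LatticeConvex G) (hx : x ∈ G) {v w e f g : ℤ × ℤ}
    (hfg : AreParents f g w) (hv : Irred v) (hvw : 0 < det v w) (hle : dot v v ≤ dot w w)
    (hxv : x + v ∈ G) (hxw : x + w ∈ G) (hxe : x + e ∈ G) (hve : 0 < det v e)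
    (hew : 0 < det e w) : x + f ∈ G ∧ 0 ≤ det v f := by
  have hF := (irred_left_of_det_eq_one hfg.direct).dot_self_pos
  have hGG := (irred_right_of_det_eq_one hfg.direct).dot_self_pos
  have hH := hfg.acute
  have hvc := eq_combination_of_det_eq_one hfg.det_left v
  have hanti : det f v = -det v f := by simp only [det]; ring
  rw [hanti] at hvc
  have hww : dot w w = dot f f + 2 * dot f g + dot g g := by
    rw [hfg.sum]; simp only [dot, Prod.fst_add, Prod.snd_add]; ring
  set m := det v w
  set n := det v f
  have hvg : v = (m - n) • f - n • g := by
    rw [hvc]; nth_rewrite 1 [hfg.sum]; module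
  have hvv : dot v v = (m - n) ^ 2 * dot f f + n ^ 2 * dot g g - 2 * n * (m - n) * dot f g := by
    rw [hvg]
    simp only [dot, Prod.fst_sub, Prod.snd_sub, Prod.smul_fst, Prod.smul_snd, smul_eq_mul]
    ring
  rw [hww, hvv] at hle
  have hn0 : 0 ≤ n := by
    by_contra hn
    have h1 : 1 ≤ -n := by omega
    have h2 : 2 ≤ m - n := by omega
    nlinarith [mul_le_mul_of_nonneg_right (by nlinarith : 4 ≤ (m - n) ^ 2) hF.le,
      mul_le_mul_of_nonneg_right (by nlinarith : 1 ≤ n ^ 2) hGG.le,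
      mul_le_mul_of_nonneg_right (by nlinarith : 2 ≤ -n * (m - n)) hH]
  have hnm : n ≤ m := by
    by_contra hn
    have h1 : 1 ≤ n - m := by omega
    have h2 : 2 ≤ n := by omega
    nlinarith [mul_le_mul_of_nonneg_right (by nlinarith : 1 ≤ (m - n) ^ 2) hF.le,
      mul_le_mul_of_nonneg_right (by nlinarith : 4 ≤ n ^ 2) hGG.le,
      mul_le_mul_of_nonneg_right (by nlinarith : 2 ≤ n * (n - m)) hH]
  refine ⟨?_, hn0⟩
  rcases hnm.lt_or_eq with hlt | heq
  · refine hG.add_mem hx hxv hxw hvw (i := 1) (by norm_num) hn0 (by omega) ?_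
    nth_rewrite 1 [hvc]; module
  · have hm1 : m = 1 := by
      have h1 : IsCoprime v.1 v.2 := irred_iff_isCoprime.1 hv
      obtain ⟨c, d, hcd⟩ := h1
      rw [hvg, heq] at hcd
      simp only [sub_self, zero_smul, zero_sub, Prod.fst_neg, Prod.snd_neg, Prod.smul_fst,
        Prod.smul_snd, smul_eq_mul] at hcd
      have : m * (-(c * g.1 + d * g.2)) = 1 := by linear_combination hcd
      rcases Int.eq_one_or_neg_one_of_mul_eq_one this with h | h <;> omega
    have hf : f = v + w := by
      rw [heq, hm1] at hvc
      rw [hvc]; module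
    rw [hf]
    exact hG.add_add_mem hx hew hve (eq_combination_of_det_eq_one hm1 e) hxv hxw hxe

/-- Mirror image of `parent_left_mem`. -/
theorem parent_right_mem (hG : LatticeConvex G) (hx : x ∈ G) {v w e f g : ℤ × ℤ}
    (hfg : AreParents f g v) (hw : Irred w) (hvw : 0 < det v w) (hle : dot w w ≤ dot v v)
    (hxv : x + v ∈ G) (hxw : x + w ∈ G) (hxe : x + e ∈ G) (hve : 0 < det v e)
    (hew : 0 < det e w) : x + g ∈ G ∧ 0 ≤ det g w := by
  have hF := (irred_left_of_det_eq_one hfg.direct).dot_self_pos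
  have hGG := (irred_right_of_det_eq_one hfg.direct).dot_self_pos
  have hH := hfg.acute
  have hwc := eq_combination_of_det_eq_one hfg.det_right w
  have hanti : det w g = -det g w := by simp only [det]; ring
  rw [hanti] at hwc
  have hvv : dot v v = dot f f + 2 * dot f g + dot g g := by
    rw [hfg.sum]; simp only [dot, Prod.fst_add, Prod.snd_add]; ring
  set m := det v w
  set n := det g w
  have hwf : w = (m - n) • g - n • f := by
    rw [hwc]; nth_rewrite 1 [hfg.sum]; module
  have hww : dot w w = (m - n) ^ 2 * dot g g + n ^ 2 * dot f f - 2 * n * (m - n) * dot f g := by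
    rw [hwf]
    simp only [dot, Prod.fst_sub, Prod.snd_sub, Prod.smul_fst, Prod.smul_snd, smul_eq_mul]
    ring
  rw [hww, hvv] at hle
  have hn0 : 0 ≤ n := by
    by_contra hn
    have h1 : 1 ≤ -n := by omega
    have h2 : 2 ≤ m - n := by omega
    nlinarith [mul_le_mul_of_nonneg_right (by nlinarith : 4 ≤ (m - n) ^ 2) hGG.le,
      mul_le_mul_of_nonneg_right (by nlinarith : 1 ≤ n ^ 2) hF.le,
      mul_le_mul_of_nonneg_right (by nlinarith : 2 ≤ -n * (m - n)) hH]
  have hnm : n ≤ m := by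
    by_contra hn
    have h1 : 1 ≤ n - m := by omega
    have h2 : 2 ≤ n := by omega
    nlinarith [mul_le_mul_of_nonneg_right (by nlinarith : 1 ≤ (m - n) ^ 2) hGG.le,
      mul_le_mul_of_nonneg_right (by nlinarith : 4 ≤ n ^ 2) hF.le,
      mul_le_mul_of_nonneg_right (by nlinarith : 2 ≤ n * (n - m)) hH]
  refine ⟨?_, hn0⟩
  rcases hnm.lt_or_eq with hlt | heq
  · refine hG.add_mem hx hxv hxw hvw (i := n) (j := 1) hn0 (by norm_num) (by omega) ?_
    nth_rewrite 1 [hwc]; module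
  · have hm1 : m = 1 := by
      have h1 : IsCoprime w.1 w.2 := irred_iff_isCoprime.1 hw
      obtain ⟨c, d, hcd⟩ := h1
      rw [hwf, heq] at hcd
      simp only [sub_self, zero_smul, zero_sub, Prod.fst_neg, Prod.snd_neg, Prod.smul_fst,
        Prod.smul_snd, smul_eq_mul] at hcd
      have : m * (-(c * f.1 + d * f.2)) = 1 := by linear_combination hcd
      rcases Int.eq_one_or_neg_one_of_mul_eq_one this with h | h <;> omega
    have hg : g = v + w := by
      rw [heq, hm1] at hwc
      rw [hwc]; module
    rw [hg]
    exact hG.add_add_mem hx hew hve (eq_combination_of_det_eq_one hm1 e) hxv hxw hxe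

/-- The maximal stencil at `x` of a set `G` of lattice points. -/
def maxSet (G : Set (ℤ × ℤ)) (x : ℤ × ℤ) : Set (ℤ × ℤ) := {e | Irred e ∧ x + e ∈ G}

variable {S : Set (ℤ × ℤ)} {e : ℤ × ℤ}

/-- Descent on ‖v‖² + ‖w‖²: the longer vector is replaced by its parent on the side of the other
one, which Stability keeps in S. If e falls between this parent and its child, these two form the
basis. Since e ∉ S, e is never on the ray of the parent. When both vectors have unit length,
Lagrange's identity gives determinant 1 and a right angle. -/
theorem exists_acute_basis (hG : LatticeConvex G) (hx : x ∈ G) (hS : S ⊆ maxSet G x)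
    (hstab : ∀ e ∈ S, ∀ f ∈ maxSet G x, IsParent f e → f ∈ S) (he : e ∈ maxSet G x) (heS : e ∉ S) :
    ∀ n : ℕ, ∀ v ∈ S, ∀ w ∈ S, dot v v + dot w w ≤ n → 0 < det v e → 0 < det e w → 0 < det v w →
      ∃ p ∈ S, ∃ q ∈ S, det p q = 1 ∧ 0 ≤ dot p q ∧ 0 < det p e ∧ 0 < det e q := by
  intro n
  induction n with
  | zero =>
    intro v hv w hw hn
    have h1 := (hS hv).1.dot_self_pos
    have h2 := (hS hw).1.dot_self_pos
    push_cast at hn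
    omega
  | succ n ih =>
    intro v hv w hw hn hve hew hvw
    have h1 := (hS hv).1.dot_self_pos
    have h2 := (hS hw).1.dot_self_pos
    push_cast at hn
    rcases le_or_gt (dot v v) (dot w w) with hle | hlt
    · by_cases hw1 : 1 < dot w w
      · obtain ⟨f, g, hfg⟩ := exists_areParents (hS hw).1 hw1
        obtain ⟨hxf, hvf⟩ := parent_left_mem hG hx hfg (hS hv).1 hvw hle (hS hv).2 (hS hw).2 he.2
          hve hew
        have hif := irred_left_of_det_eq_one hfg.direct
        have hf : f ∈ S := hstab w hw f ⟨hif, hxf⟩ ⟨g, Or.inl hfg⟩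
        have hG1 := (irred_right_of_det_eq_one hfg.direct).dot_self_pos
        have hH := hfg.acute
        have hF := hif.dot_self_pos
        have hfw : dot f w = dot f f + dot f g := by
          rw [hfg.sum]; simp only [dot, Prod.fst_add, Prod.snd_add]; ring
        have hww : dot w w = dot f f + 2 * dot f g + dot g g := by
          rw [hfg.sum]; simp only [dot, Prod.fst_add, Prod.snd_add]; ring
        rcases lt_trichotomy (det f e) 0 with hfe | hfe | hfe
        · refine ih v hv f hf (by omega) hve ?_ ?_
          · simp only [det] at hfe ⊢; linarith
          · rcases hvf.lt_or_eq with h | h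
            · exact h
            · rcases (hS hv).1.eq_or_eq_neg hif h.symm with h | h
              · rw [h] at hfe; omega
              · have := hfg.det_left
                rw [h] at this
                simp only [det, Prod.fst_neg, Prod.snd_neg] at this hvw
                linarith
        · rcases hif.eq_or_eq_neg he.1 hfe with h | h
          · exact absurd (h ▸ hf) heS
          · have := hfg.det_left
            rw [h] at hew
            simp only [det, Prod.fst_neg, Prod.snd_neg] at this hew
            linarith
        · exact ⟨f, hf, w, hw, hfg.det_left, by omega, hfe, hew⟩
      · have hl := lagrange_identity v w
        have h3 : dot v v = 1 := by omega
        have h4 : dot w w = 1 := by omega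
        rw [h3, h4] at hl
        exact ⟨v, hv, w, hw, by nlinarith [sq_nonneg (dot v w)], by nlinarith, hve, hew⟩
    · have hv1 : 1 < dot v v := by omega
      obtain ⟨f, g, hfg⟩ := exists_areParents (hS hv).1 hv1
      obtain ⟨hxg, hgw⟩ := parent_right_mem hG hx hfg (hS hw).1 hvw hlt.le (hS hv).2 (hS hw).2 he.2
        hve hew
      have hig := irred_right_of_det_eq_one hfg.direct
      have hg : g ∈ S := hstab v hv g ⟨hig, hxg⟩ ⟨f, Or.inr hfg⟩
      have hF := (irred_left_of_det_eq_one hfg.direct).dot_self_pos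
      have hH := hfg.acute
      have hG1 := hig.dot_self_pos
      have hvg : dot v g = dot g g + dot f g := by
        rw [hfg.sum]; simp only [dot, Prod.fst_add, Prod.snd_add]; ring
      have hvv : dot v v = dot f f + 2 * dot f g + dot g g := by
        rw [hfg.sum]; simp only [dot, Prod.fst_add, Prod.snd_add]; ring
      rcases lt_trichotomy (det g e) 0 with hge | hge | hge
      · exact ⟨v, hv, g, hg, hfg.det_right, by omega, hve,
          by simp only [det] at hge ⊢; linarith⟩
      · rcases hig.eq_or_eq_neg he.1 hge with h | h
        · exact absurd (h ▸ hg) heS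
        · have := hfg.det_right
          rw [h] at hve
          simp only [det, Prod.fst_neg, Prod.snd_neg] at this hve
          linarith
      · refine ih g hg w hw (by omega) hge hew ?_
        rcases hgw.lt_or_eq with h | h
        · exact h
        · rcases hig.eq_or_eq_neg (hS hw).1 h.symm with h | h
          · rw [h] at hew
            simp only [det] at hew hge
            linarith
          · have := hfg.det_right
            rw [h] at hvw
            simp only [det, Prod.fst_neg, Prod.snd_neg] at this hvw
            linarith

end

/-! ### Candidates for refinement and propagation of parallelogram inequalities. -/

section

variable {G : Set (ℤ × ℤ)} {x : ℤ × ℤ} {S : Set (ℤ × ℤ)} {e : ℤ × ℤ}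

theorem exists_between_of_finite {A B : Set ℝ} (hA : A.Finite) (hB : B.Finite)
    (h : ∀ a ∈ A, ∀ b ∈ B, a ≤ b) : ∃ s, (∀ a ∈ A, a ≤ s) ∧ ∀ b ∈ B, s ≤ b := by
  rcases A.eq_empty_or_nonempty with rfl | hne
  · obtain ⟨s, hs⟩ := hB.bddBelow
    exact ⟨s, by simp, fun b hb => hs hb⟩
  · exact ⟨sSup A, fun a ha => le_csSup hA.bddAbove ha,
      fun b hb => csSup_le hne fun a ha => h a ha b hb⟩

/-- Separation argument. If no pair surrounds e, the identity ⟨v, e⟩ det(e, w) + ⟨w, e⟩ det(v, e) =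
‖e‖² det(v, w) lets a number s be inserted between two finite sets of slopes. The linear form ⟨z, e⟩
- s det(z, e) is then nonpositive on S, hence on its cone, yet equals ‖e‖² > 0 at e. -/
theorem exists_surrounding_pair (hfin : S.Finite) (hirr : ∀ v ∈ S, Irred v) (he : Irred e)
    (heS : e ∉ S) (hcone : toPlane e ∈ coneHull S) :
    ∃ v ∈ S, ∃ w ∈ S, 0 < det v e ∧ 0 < det e w ∧ 0 < det v w := by
  by_contra! hcon
  obtain ⟨s, hs1, hs2⟩ := exists_between_of_finite
    (A := (fun v => (dot v e : ℝ) / det v e) '' {v ∈ S | 0 < det v e})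
    (B := (fun w => -(dot w e : ℝ) / det e w) '' {w ∈ S | 0 < det e w})
    ((hfin.subset (Set.sep_subset _ _)).image _) ((hfin.subset (Set.sep_subset _ _)).image _) (by
      rintro _ ⟨v, ⟨hv, hve⟩, rfl⟩ _ ⟨w, ⟨hw, hew⟩, rfl⟩
      have h1 := hcon v hv w hw hve hew
      have h2 : dot v e * det e w ≤ -dot w e * det v e := by
        have h3 : dot v e * det e w + dot w e * det v e = dot e e * det v w := by
          simp only [dot, det]; ring
        nlinarith [mul_nonneg (dot_self_nonneg e) (neg_nonneg.2 h1)]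
      have h4 : (0 : ℝ) < det v e := by exact_mod_cast hve
      have h5 : (0 : ℝ) < det e w := by exact_mod_cast hew
      dsimp only
      rw [div_le_div_iff₀ h4 h5]
      exact_mod_cast h2)
  have hle : ∀ z ∈ coneHull S,
      (z.1 * e.1 + z.2 * e.2) - s * (z.1 * e.2 - z.2 * e.1) ≤ 0 := by
    intro z hz
    refine Submodule.span_induction (p := fun z _ =>
      (z.1 * e.1 + z.2 * e.2) - s * (z.1 * e.2 - z.2 * e.1) ≤ (0 : ℝ)) ?_ (by simp) ?_ ?_ hz
    · rintro _ ⟨v, hv, rfl⟩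
      have e1 : (toPlane v).1 * e.1 + (toPlane v).2 * e.2 = (dot v e : ℝ) := by
        simp [toPlane, dot]
      have e2 : (toPlane v).1 * e.2 - (toPlane v).2 * e.1 = (det v e : ℝ) := by
        simp [toPlane, det]
      rw [e1, e2]
      rcases lt_trichotomy (det v e) 0 with h | h | h
      · have h' : 0 < det e v := by simp only [det] at h ⊢; linarith
        have h3 := hs2 _ ⟨v, ⟨hv, h'⟩, rfl⟩
        dsimp only at h3
        rw [le_div_iff₀ (by exact_mod_cast h')] at h3
        have h4 : (det v e : ℝ) = -det e v := by simp only [det]; push_cast; ring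
        rw [h4]; linarith
      · have h' : det e v = 0 := by simp only [det] at h ⊢; linarith
        rcases he.eq_or_eq_neg (hirr v hv) h' with rfl | rfl
        · exact absurd hv heS
        · have : dot (-e) e = -dot e e := by
            simp only [dot, Prod.fst_neg, Prod.snd_neg]; ring
          have h5 : (0 : ℝ) ≤ dot e e := by exact_mod_cast dot_self_nonneg e
          rw [h, this]; push_cast; linarith
      · have h3 := hs1 _ ⟨v, ⟨hv, h⟩, rfl⟩
        dsimp only at h3
        rw [div_le_iff₀ (by exact_mod_cast h)] at h3
        linarith
    · intro y z _ _ hy hz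
      simp only [Prod.fst_add, Prod.snd_add]
      linarith
    · intro c z _ hz
      have := mul_nonpos_of_nonneg_of_nonpos c.2 hz
      simp only [Prod.smul_fst, Prod.smul_snd]
      change (c : ℝ) * z.1 * e.1 + (c : ℝ) * z.2 * e.2
        - s * ((c : ℝ) * z.1 * e.2 - (c : ℝ) * z.2 * e.1) ≤ 0
      linarith
  have h1 := hle _ hcone
  have h2 : (0 : ℝ) < dot e e := by exact_mod_cast he.dot_self_pos
  simp only [toPlane] at h1
  simp only [dot] at h2
  push_cast at h2
  nlinarith

theorem irred_add_of_det_eq_one {p q : ℤ × ℤ} (h : det p q = 1) : Irred (p + q) := by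
  refine irred_left_of_det_eq_one (g := q) ?_
  simp only [det, Prod.fst_add, Prod.snd_add] at h ⊢
  linarith

theorem eq_one_of_irred_smul {p q : ℤ × ℤ} {a : ℤ} (h : Irred (a • p + a • q)) (ha : 0 < a) :
    a = 1 := by
  obtain ⟨c, d, hcd⟩ := irred_iff_isCoprime.1 h
  simp only [Prod.fst_add, Prod.snd_add, Prod.smul_fst, Prod.smul_snd, smul_eq_mul] at hcd
  have : a * (c * (p.1 + q.1) + d * (p.2 + q.2)) = 1 := by linear_combination hcd
  rcases Int.eq_one_or_neg_one_of_mul_eq_one this with h | h <;> omega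

/-- An element of the maximal stencil missing from a stencil lies in the open cone generated by
the parents of a candidate for refinement. -/
theorem exists_candidate (hG : LatticeConvex G) (hx : x ∈ G) (hfin : S.Finite)
    (hS : S ⊆ maxSet G x) (hstab : ∀ e ∈ S, ∀ f ∈ maxSet G x, IsParent f e → f ∈ S)
    (hvis : coneHull S = coneHull (maxSet G x)) (he : e ∈ maxSet G x) (heS : e ∉ S) :
    ∃ p ∈ S, ∃ q ∈ S, det p q = 1 ∧ 0 ≤ dot p q ∧ p + q ∈ maxSet G x ∧ p + q ∉ S ∧
      ∃ a b : ℤ, 0 < a ∧ 0 < b ∧ e = a • p + b • q := by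
  have hcone : toPlane e ∈ coneHull S := by
    rw [hvis]; exact PointedCone.subset_hull ⟨e, he, rfl⟩
  obtain ⟨v, hv, w, hw, hve, hew, hvw⟩ :=
    exists_surrounding_pair hfin (fun v hv => (hS hv).1) he.1 heS hcone
  obtain ⟨p, hp, q, hq, hpq, hdot, hpe, heq⟩ := exists_acute_basis hG hx hS hstab he heS
    (dot v v + dot w w).toNat v hv w hw (Int.self_le_toNat _) hve hew hvw
  have hcomb := eq_combination_of_det_eq_one hpq e
  generalize det e q = a at *
  generalize det p e = b at *
  clear hv hw hve hew hvw
  -- Subtractive Euclidean algorithm on (a, b): as long as p + q stays in S, pass to whichever of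
  -- the bases (p + q, q), (p, p + q) has e in its open cone. If a = b, irreducibility gives e = p +
  -- q, contrary to e ∉ S.
  obtain ⟨n, hn⟩ : ∃ n : ℕ, a + b ≤ n := ⟨(a + b).toNat, Int.self_le_toNat _⟩
  induction n generalizing p q a b with
  | zero => push_cast at hn; omega
  | succ n ih =>
    push_cast at hn
    have hmem : p + q ∈ maxSet G x := ⟨irred_add_of_det_eq_one hpq,
      hG.add_add_mem hx heq hpe hcomb (hS hp).2 (hS hq).2 he.2⟩
    by_cases hpqS : p + q ∈ S
    · rcases lt_trichotomy a b with hab | hab | hab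
      · refine ih (p + q) hpqS q hq ?_ ?_ a heq (b - a) (by omega) ?_ (by omega)
        · simp only [det, Prod.fst_add, Prod.snd_add] at hpq ⊢; linarith
        · have := dot_self_nonneg q
          simp only [dot, Prod.fst_add, Prod.snd_add] at *; linarith
        · rw [hcomb]; module
      · subst hab
        have := eq_one_of_irred_smul (hcomb ▸ he.1) hpe
        subst this
        rw [one_smul, one_smul] at hcomb
        exact absurd (hcomb ▸ hpqS) heS
      · refine ih p hp (p + q) hpqS ?_ ?_ (a - b) (by omega) b hpe ?_ (by omega)
        · simp only [det, Prod.fst_add, Prod.snd_add] at hpq ⊢; linarith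
        · have := dot_self_nonneg p
          simp only [dot, Prod.fst_add, Prod.snd_add] at *; linarith
        · rw [hcomb]; module
    · exact ⟨p, hp, q, hq, hpq, hdot, hmem, hpqS, a, b, heq, hpe, hcomb⟩

theorem dot_left_lt {p q : ℤ × ℤ} {a b : ℤ} (hdot : 0 ≤ dot p q) (hq : Irred q)
    (ha : 0 < a) (hb : 0 < b) : dot p p < dot (a • p + b • q) (a • p + b • q) := by
  have h : dot (a • p + b • q) (a • p + b • q) =
      a ^ 2 * dot p p + 2 * (a * b) * dot p q + b ^ 2 * dot q q := by
    simp only [dot, Prod.fst_add, Prod.snd_add, Prod.smul_fst, Prod.smul_snd, smul_eq_mul]; ring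
  rw [h]
  have h1 := hq.dot_self_pos
  have h2 := dot_self_nonneg p
  nlinarith [mul_nonneg (mul_pos ha hb).le hdot, mul_pos (pow_pos hb 2) h1,
    mul_nonneg (by nlinarith : 0 ≤ a ^ 2 - 1) h2]

theorem dot_right_lt {p q : ℤ × ℤ} {a b : ℤ} (hdot : 0 ≤ dot p q) (hp : Irred p)
    (ha : 0 < a) (hb : 0 < b) : dot q q < dot (a • p + b • q) (a • p + b • q) := by
  rw [add_comm]
  exact dot_left_lt (by simpa only [dot, mul_comm] using hdot) hp hb ha

/-- The parallelogram inequality propagates from a lattice vector to its descendants, given the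
segment inequalities of smaller size. -/
theorem parallelogram_of_combination (hG : LatticeConvex G) {u : ℤ × ℤ → ℝ} (hx : x ∈ G)
    (he : e ∈ maxSet G x)
    (hseg : ∀ y ∈ G, ∀ f ∈ maxSet G y, dot f f < dot e e → y - f ∈ G →
      0 ≤ u (y + f) - 2 * u y + u (y - f))
    {p q : ℤ × ℤ} (hpq : det p q = 1) (hdot : 0 ≤ dot p q) (hp : x + p ∈ G) (hq : x + q ∈ G)
    {a b : ℤ} (ha : 0 < a) (hb : 0 < b) (hcomb : e = a • p + b • q)
    (hpar : 0 ≤ u (x + (p + q)) - u (x + p) - u (x + q) + u x) :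
    ∃ f g, AreParents f g e ∧ x + f ∈ G ∧ x + g ∈ G ∧
      0 ≤ u (x + e) - u (x + f) - u (x + g) + u x := by
  obtain ⟨n, hn⟩ : ∃ n : ℕ, a + b ≤ n := ⟨(a + b).toNat, Int.self_le_toNat _⟩
  induction n generalizing p q a b with
  | zero => push_cast at hn; omega
  | succ n ih =>
    push_cast at hn
    have hip := irred_left_of_det_eq_one hpq
    have hiq := irred_right_of_det_eq_one hpq
    have hmem : x + (p + q) ∈ G := hG.add_add_mem hx ha hb hcomb hp hq he.2
    rcases lt_trichotomy a b with hab | hab | hab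
    · have hcomb' : e = a • (p + q) + (b - a) • q := by rw [hcomb]; module
      have hdet' : det (p + q) q = 1 := by
        simp only [det, Prod.fst_add, Prod.snd_add] at hpq ⊢; linarith
      have hdot' : 0 ≤ dot (p + q) q := by
        have := dot_self_nonneg q
        simp only [dot, Prod.fst_add, Prod.snd_add] at *; linarith
      have hmem' := hG.add_add_mem hx ha (by omega) hcomb' hmem hq he.2
      refine ih hdet' hdot' hmem hq ha (by omega : 0 < b - a) hcomb' ?_ (by omega)
      have hlt := dot_right_lt hdot hip ha hb
      rw [← hcomb] at hlt
      -- The parallelogram form of the basis (p + q, q) is that of (p, q) plus the segment form at x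
      -- + p + q in direction q, and q is shorter than e.
      have hs := hseg _ hmem q ⟨hiq, by rwa [add_assoc]⟩ hlt
        (by rwa [show x + (p + q) - q = x + p by abel])
      rw [show x + (p + q) - q = x + p by abel, add_assoc] at hs
      linarith
    · subst hab
      have := eq_one_of_irred_smul (hcomb ▸ he.1) ha
      subst this
      rw [one_smul, one_smul] at hcomb
      exact ⟨p, q, ⟨hpq, hdot, hcomb⟩, hp, hq, hcomb ▸ hpar⟩
    · have hcomb' : e = (a - b) • p + b • (p + q) := by rw [hcomb]; module
      have hdet' : det p (p + q) = 1 := by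
        simp only [det, Prod.fst_add, Prod.snd_add] at hpq ⊢; linarith
      have hdot' : 0 ≤ dot p (p + q) := by
        have := dot_self_nonneg p
        simp only [dot, Prod.fst_add, Prod.snd_add] at *; linarith
      have hmem' := hG.add_add_mem hx (by omega) hb hcomb' hp hmem he.2
      refine ih hdet' hdot' hp hmem (by omega : 0 < a - b) hb hcomb' ?_ (by omega)
      have hlt := dot_left_lt hdot hiq ha hb
      rw [← hcomb] at hlt
      have hs := hseg _ hmem p ⟨hip, by rwa [show x + (p + q) + p = x + (p + (p + q)) by abel]⟩ hlt
        (by rwa [show x + (p + q) - p = x + q by abel])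
      rw [show x + (p + q) - p = x + q by abel,
        show x + (p + q) + p = x + (p + (p + q)) by abel] at hs
      linarith

end

/-! ### All segment and triangle inequalities from those of a stencil family. -/

section

variable {G : Set (ℤ × ℤ)}

theorem AreParents.dot_left_lt {f g e : ℤ × ℤ} (h : AreParents f g e) : dot f f < dot e e := by
  have := StencilCone.dot_left_lt (a := 1) (b := 1) h.acute
    (irred_right_of_det_eq_one h.direct) one_pos one_pos
  rwa [one_smul, one_smul, ← h.sum] at this

theorem AreParents.dot_right_lt {f g e : ℤ × ℤ} (h : AreParents f g e) : dot g g < dot e e := by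
  have := StencilCone.dot_right_lt (a := 1) (b := 1) h.acute
    (irred_left_of_det_eq_one h.direct) one_pos one_pos
  rwa [one_smul, one_smul, ← h.sum] at this

/-- The inequalities indexed by stencils imply all the segment and triangle inequalities, and the
parallelogram inequalities for all missing vectors. -/
theorem forms_nonneg (hG : LatticeConvex G) {S : ℤ × ℤ → Set (ℤ × ℤ)}
    (hfin : ∀ x ∈ G, (S x).Finite) (hS : ∀ x ∈ G, S x ⊆ maxSet G x)
    (hstab : ∀ x ∈ G, ∀ e ∈ S x, ∀ f ∈ maxSet G x, IsParent f e → f ∈ S x)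
    (hvis : ∀ x ∈ G, coneHull (S x) = coneHull (maxSet G x)) {u : ℤ × ℤ → ℝ}
    (hseg : ∀ x ∈ G, ∀ e ∈ S x, x - e ∈ G → 0 ≤ u (x + e) - 2 * u x + u (x - e))
    (htri : ∀ x ∈ G, ∀ e ∈ S x, ∀ f g, AreParents f g e → x - f ∈ G → x - g ∈ G →
      0 ≤ u (x + e) + u (x - f) + u (x - g) - 3 * u x)
    (hpar : ∀ x ∈ G, ∀ e ∈ maxSet G x, e ∉ S x → ∀ f ∈ S x, ∀ g ∈ S x, AreParents f g e →
      0 ≤ u (x + e) - u (x + f) - u (x + g) + u x)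
    {x : ℤ × ℤ} (hx : x ∈ G) {e : ℤ × ℤ} (he : e ∈ maxSet G x) :
    (x - e ∈ G → 0 ≤ u (x + e) - 2 * u x + u (x - e)) ∧
    (∀ f g, AreParents f g e → x - f ∈ G → x - g ∈ G →
      0 ≤ u (x + e) + u (x - f) + u (x - g) - 3 * u x) ∧
    (e ∉ S x → ∃ f g, AreParents f g e ∧ x + f ∈ G ∧ x + g ∈ G ∧
      0 ≤ u (x + e) - u (x + f) - u (x + g) + u x) := by
  obtain ⟨n, hn⟩ : ∃ n : ℕ, dot e e < n := ⟨(dot e e).toNat + 1, by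
    push_cast; have := Int.self_le_toNat (dot e e); omega⟩
  induction n generalizing x e with
  | zero => have := dot_self_nonneg e; push_cast at hn; omega
  | succ n ih =>
    push_cast at hn
    have hseg' : ∀ y ∈ G, ∀ f ∈ maxSet G y, dot f f < dot e e → y - f ∈ G →
        0 ≤ u (y + f) - 2 * u y + u (y - f) :=
      fun y hy f hf hlt => (ih hy hf (by omega)).1
    -- Stated for all vectors of the same length as e, because it is also needed at -e.
    have hpar' : ∀ e' ∈ maxSet G x, dot e' e' = dot e e → e' ∉ S x →
        ∃ f g, AreParents f g e' ∧ x + f ∈ G ∧ x + g ∈ G ∧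
          0 ≤ u (x + e') - u (x + f) - u (x + g) + u x := by
      intro e' he' heq heS
      obtain ⟨p, hp, q, hq, hpq, hdot, hmem, hnot, a, b, ha, hb, hcomb⟩ :=
        exists_candidate hG hx (hfin x hx) (hS x hx) (hstab x hx) (hvis x hx) he' heS
      exact parallelogram_of_combination hG hx he' (by rwa [heq]) hpq hdot (hS x hx hp).2
        (hS x hx hq).2 ha hb hcomb (hpar x hx _ hmem hnot p hp q hq ⟨hpq, hdot, rfl⟩)
    refine ⟨fun hxe => ?_, fun f g hfg hxf hxg => ?_, hpar' e he rfl⟩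
    · by_cases heS : e ∈ S x
      · exact hseg x hx e heS hxe
      obtain ⟨f, g, hfg, hxf, hxg, hP⟩ := hpar' e he rfl heS
      have hne : -e ∈ maxSet G x := ⟨he.1.neg, by rwa [← sub_eq_add_neg]⟩
      by_cases heS' : -e ∈ S x
      -- The segment form of e is its parallelogram form plus the triangle form of -e.
      · have hT := htri x hx (-e) heS' _ _ hfg.neg (by rwa [sub_neg_eq_add])
          (by rwa [sub_neg_eq_add])
        rw [sub_neg_eq_add, sub_neg_eq_add, ← sub_eq_add_neg] at hT
        linarith
      · have hdd : dot (-e) (-e) = dot e e := by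
          simp only [dot, Prod.fst_neg, Prod.snd_neg]; ring
        obtain ⟨f', g', hfg', hxf', hxg', hP'⟩ := hpar' (-e) hne hdd heS'
        obtain ⟨rfl, rfl⟩ := hfg.neg.unique hfg'
        rw [← sub_eq_add_neg] at hxf' hxg'
        rw [← sub_eq_add_neg, ← sub_eq_add_neg, ← sub_eq_add_neg] at hP'
        -- The segment form of e is the sum of the parallelogram forms of e and -e and of the
        -- segment forms of the two parents.
        have h1 := hseg' x hx f ⟨irred_left_of_det_eq_one hfg.direct, hxf⟩ hfg.dot_left_lt hxf'
        have h2 := hseg' x hx g ⟨irred_right_of_det_eq_one hfg.direct, hxg⟩ hfg.dot_right_lt hxg'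
        linarith
    · by_cases heS : e ∈ S x
      · exact htri x hx e heS f g hfg hxf hxg
      obtain ⟨f', g', hfg', hxf', hxg', hP⟩ := hpar' e he rfl heS
      obtain ⟨rfl, rfl⟩ := hfg.unique hfg'
      -- The triangle form of e is its parallelogram form plus the segment forms of the two parents.
      have h1 := hseg' x hx f' ⟨irred_left_of_det_eq_one hfg.direct, hxf'⟩ hfg.dot_left_lt hxf
      have h2 := hseg' x hx g' ⟨irred_right_of_det_eq_one hfg.direct, hxg'⟩ hfg.dot_right_lt hxg
      linarith

end

/-! ### Convexity along lattice lines, and lattice points of triangles. -/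

section

variable {G : Set (ℤ × ℤ)} {x : ℤ × ℤ} {u : ℤ × ℤ → ℝ}

theorem le_of_second_difference_nonneg {g : ℕ → ℝ} {p : ℕ}
    (h : ∀ k, k + 2 ≤ p → 0 ≤ g (k + 2) - 2 * g (k + 1) + g k) :
    ∀ k ≤ p, g 0 + k * (g 1 - g 0) ≤ g k := by
  have hd : ∀ k, k + 1 ≤ p → g 1 - g 0 ≤ g (k + 1) - g k := by
    intro k
    induction k with
    | zero => intro _; rfl
    | succ k ih =>
      intro hk
      have h1 := ih (by omega)
      have h2 := h k hk
      linarith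
  intro k
  induction k with
  | zero => intro _; simp
  | succ k ih =>
    intro hk
    have h1 := ih (by omega)
    have h2 := hd k hk
    push_cast
    linarith

theorem ray_le (hG : LatticeConvex G)
    (hseg : ∀ x ∈ G, ∀ e ∈ maxSet G x, x - e ∈ G → 0 ≤ u (x + e) - 2 * u x + u (x - e))
    (hx : x ∈ G) {e : ℤ × ℤ} (he : Irred e) {p : ℕ} (hp : x + p • e ∈ G) :
    u x + p * (u (x + e) - u x) ≤ u (x + p • e) := by
  have hmem : ∀ k ≤ p, x + k • e ∈ G := by
    intro k hk
    rcases Nat.eq_zero_or_pos p with rfl | hp0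
    · rwa [Nat.le_zero.1 hk]
    · refine hG.add_mem hx hp hp (n := p) (i := k) (j := 0) (by omega) (by omega) le_rfl
        (by omega) ?_
      module
  have := le_of_second_difference_nonneg (g := fun k => u (x + k • e)) (p := p) ?_ p le_rfl
  · simpa using this
  · intro k hk
    have h1 : x + (k + 2) • e = x + (k + 1) • e + e := by module
    have h2 : x + k • e = x + (k + 1) • e - e := by module
    rw [h1, h2]
    exact hseg _ (hmem _ (by omega)) e ⟨he, h1 ▸ hmem _ hk⟩ (h2 ▸ hmem _ (by omega))

/-- Convexity along lattice segments. -/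
theorem segment_convex (hG : LatticeConvex G)
    (hseg : ∀ x ∈ G, ∀ e ∈ maxSet G x, x - e ∈ G → 0 ≤ u (x + e) - 2 * u x + u (x - e))
    (hx : x ∈ G) {y z : ℤ × ℤ} (hy : y ∈ G) (hz : z ∈ G) (hdet : det (y - x) (z - x) = 0)
    (hdot : dot (y - x) (z - x) < 0) :
    0 ≤ -dot (y - x) (z - x) * (u y - u x) + dot (y - x) (y - x) * (u z - u x) := by
  have hv : y - x ≠ 0 := by
    intro h
    rw [h] at hdot
    simp [dot] at hdot
  obtain ⟨p, e, hp, he, hpe⟩ := exists_irred_smul hv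
  have hdet' : det e (z - x) = 0 := by
    rw [hpe] at hdet
    have : det (p • e) (z - x) = p * det e (z - x) := by
      simp only [det, Prod.smul_fst, Prod.smul_snd, smul_eq_mul]; ring
    rw [this] at hdet
    exact (mul_eq_zero.1 hdet).resolve_left hp.ne'
  obtain ⟨k, hk⟩ := he.eq_smul_of_det_eq_zero hdet'
  have hd1 : dot (y - x) (z - x) = p * k * dot e e := by
    rw [hpe, hk]; simp only [dot, Prod.smul_fst, Prod.smul_snd, smul_eq_mul]; ring
  have hd2 : dot (y - x) (y - x) = p * p * dot e e := by
    rw [hpe]; simp only [dot, Prod.smul_fst, Prod.smul_snd, smul_eq_mul]; ring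
  have hn := he.dot_self_pos
  have hk0 : k < 0 := by
    rw [hd1] at hdot
    by_contra hk
    have := mul_nonneg (mul_nonneg hp.le (not_lt.1 hk)) hn.le
    omega
  lift p to ℕ using hp.le
  obtain ⟨q, rfl⟩ : ∃ q : ℕ, k = -q := ⟨k.natAbs, by omega⟩
  have hy' : y = x + p • e := by rw [← natCast_zsmul, ← hpe]; abel
  have hz' : z = x + q • (-e) := by rw [← natCast_zsmul, smul_neg, ← neg_smul, ← hk]; abel
  have hxe : x + e ∈ G :=
    hG.add_mem hx (hy' ▸ hy) (hy' ▸ hy) (n := p) (i := 1) (j := 0) hp (by omega) le_rfl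
      (by omega) (by module)
  have hxe' : x - e ∈ G := by
    rw [sub_eq_add_neg]
    exact hG.add_mem hx (hz' ▸ hz) (hz' ▸ hz) (n := q) (i := 1) (j := 0) (by omega) (by omega)
      le_rfl (by omega) (by module)
  have h1 := ray_le hG hseg hx he (hy' ▸ hy)
  have h2 := ray_le hG hseg hx he.neg (hz' ▸ hz)
  rw [← hy'] at h1
  rw [← hz', ← sub_eq_add_neg] at h2
  have h3 := hseg x hx e ⟨he, hxe⟩ hxe'
  rw [hd1, hd2]
  push_cast
  have hp' : (0 : ℝ) < p := by exact_mod_cast hp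
  have hq' : (0 : ℝ) < q := by
    have : 0 < q := by omega
    exact_mod_cast this
  have hn' : (0 : ℝ) < dot e e := by exact_mod_cast hn
  -- With y - x = pe and z - x = -qe, the weights of the goal are q and p times the common factor
  -- p‖e‖².
  have h4 : 0 ≤ q * (u y - u x) + p * (u z - u x) := by
    nlinarith [mul_le_mul_of_nonneg_left h1 hq'.le, mul_le_mul_of_nonneg_left h2 hp'.le,
      mul_nonneg (mul_nonneg hp'.le hq'.le) h3]
  have h5 := mul_nonneg (mul_nonneg hp'.le hn'.le) h4
  linarith

/-- If v is a proper multiple of an irreducible e, take e. Otherwise complete v to a basis of ℤ² and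
slide the second basis vector along v into the triangle 0, v, w, on the lattice line next to the
side spanned by v. -/
theorem exists_lattice_point {v w : ℤ × ℤ} (h : 2 ≤ det v w) :
    ∃ (p : ℤ × ℤ) (i j : ℤ), 0 ≤ i ∧ 0 ≤ j ∧ i + j ≤ det v w ∧ det v w • p = i • v + j • w ∧
      p ≠ 0 ∧ p ≠ v ∧ p ≠ w := by
  have hv : v ≠ 0 := by
    rintro rfl
    simp [det] at h
  obtain ⟨d, e, hd, he, hde⟩ := exists_irred_smul hv
  rcases (show 1 ≤ d by omega).lt_or_eq with hd1 | rfl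
  · have hdet : det v w = d * det e w := by
      rw [hde]; simp only [det, Prod.smul_fst, Prod.smul_snd, smul_eq_mul]; ring
    have hpos : 0 < det e w := by
      by_contra hn
      nlinarith
    refine ⟨e, det e w, 0, hpos.le, le_rfl, by nlinarith, ?_, he.ne_zero, ?_, ?_⟩
    · rw [hdet, hde]; module
    · intro hev
      rw [← hev] at hdet
      nlinarith
    · rintro rfl
      simp only [det] at hpos
      linarith
  · rw [one_smul] at hde
    subst hde
    obtain ⟨a, b, hab⟩ := irred_iff_isCoprime.1 he
    set m := det v w with hm
    have hw : w = det w (-b, a) • v + m • (-b, a) := by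
      have h1 : det v (-b, a) = 1 := by simp only [det]; linarith
      exact eq_combination_of_det_eq_one h1 w
    set k := det w (-b, a)
    -- This is the ceiling of k / m, so that the coefficient mt - k of v is the residue of -k modulo
    -- m, between 0 and m - 1.
    set t := -(-k / m)
    set p := (-b, a) + t • v with hp
    have hr : -k % m = m * t - k := by
      rw [Int.emod_def]; ring
    have h0 := Int.emod_nonneg (-k) (by omega : m ≠ 0)
    have h1 := Int.emod_lt_of_pos (-k) (by omega : 0 < m)
    rw [hr] at h0 h1
    have hvp : det v p = 1 := by
      simp only [hp, det, Prod.fst_add, Prod.snd_add, Prod.smul_fst, Prod.smul_snd, smul_eq_mul]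
      linarith
    refine ⟨p, m * t - k, 1, h0, by omega, by omega, ?_, ?_, ?_, ?_⟩
    · rw [hp]; nth_rewrite 1 [hw]; module
    · intro h2; rw [h2] at hvp; simp [det] at hvp
    · intro h2; rw [h2] at hvp; simp only [det] at hvp; linarith
    · intro h2; rw [h2] at hvp; omega

end

/-! ### Convexity on lattice triangles. -/

section

variable {G : Set (ℤ × ℤ)} {x : ℤ × ℤ} {u : ℤ × ℤ → ℝ} {y₁ y₂ y₃ z : ℤ × ℤ}

/-- Twice the signed area of a lattice triangle. -/
def area (a b c : ℤ × ℤ) : ℤ := det (b - a) (c - a)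

theorem area_rotate (a b c : ℤ × ℤ) : area b c a = area a b c := by
  simp only [area, det, Prod.fst_sub, Prod.snd_sub]; ring

theorem area_add (a b c x : ℤ × ℤ) :
    area x b c + area x c a + area x a b = area a b c := by
  simp only [area, det, Prod.fst_sub, Prod.snd_sub]; ring

/-- The point `x` lies in the direct triangle `a, b, c`. -/
structure InTriangle (a b c x : ℤ × ℤ) : Prop where
  fst : 0 ≤ area x b c
  snd : 0 ≤ area x c a
  trd : 0 ≤ area x a b

theorem InTriangle.rotate (h : InTriangle y₁ y₂ y₃ x) : InTriangle y₂ y₃ y₁ x :=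
  ⟨h.snd, h.trd, h.fst⟩

/-- The defect of convexity of `u` at a point of a triangle. -/
def defect (u : ℤ × ℤ → ℝ) (a b c x : ℤ × ℤ) : ℝ :=
  area a b c * u x - area x b c * u a - area x c a * u b - area x a b * u c

theorem defect_rotate (u : ℤ × ℤ → ℝ) (a b c x : ℤ × ℤ) :
    defect u b c a x = defect u a b c x := by
  simp only [defect, area_rotate a b c]; ring

theorem barycentric (a b c x : ℤ × ℤ) :
    area a b c • x = area x b c • a + area x c a • b + area x a b • c := by
  ext <;> simp only [area, det, Prod.fst_sub, Prod.snd_sub, Prod.fst_add, Prod.snd_add,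
    Prod.smul_fst, Prod.smul_snd, smul_eq_mul] <;> ring

theorem eq_of_area_eq (hD : 0 < area y₁ y₂ y₃) (h1 : area x y₂ y₃ = area z y₂ y₃)
    (h2 : area x y₃ y₁ = area z y₃ y₁) (h3 : area x y₁ y₂ = area z y₁ y₂) : x = z := by
  have e1 := barycentric y₁ y₂ y₃ x
  rw [h1, h2, h3, ← barycentric] at e1
  exact smul_right_injective _ hD.ne' e1

theorem area_left_self (a b : ℤ × ℤ) : area a a b = 0 := by simp [area, det]

theorem area_right_self (a b : ℤ × ℤ) : area a b a = 0 := by simp [area, det]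

theorem InTriangle.area_lt (h : InTriangle y₁ y₂ y₃ x) (hD : 0 < area y₁ y₂ y₃) (hx : x ≠ y₁) :
    area x y₂ y₃ < area y₁ y₂ y₃ := by
  have h0 := area_add y₁ y₂ y₃ x
  have h2 := h.snd
  have h3 := h.trd
  by_contra hcon
  refine hx (eq_of_area_eq hD (by omega) ?_ ?_)
  · rw [area_right_self]; omega
  · rw [area_left_self]; omega

/-- The ratio conditions place x in the smaller triangle z, y₂, y₃, where `ih` applies. With F the
defect in the large triangle, this bounds F(x) times the y₁-coordinate of z by F(z) times that of x.
As F(z) ≤ F(x) and F(x) > 0, the y₁-coordinate of z is at most that of x; the ratio conditions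
extend this to the other two coordinates, and equal sums force z = x. -/
theorem eq_of_le_of_min_ratio (hD : 0 < area y₁ y₂ y₃)
    (hx : InTriangle y₁ y₂ y₃ x) (hz : InTriangle y₁ y₂ y₃ z) (hzy : z ≠ y₁)
    (hpos : 0 < area z y₂ y₃)
    (h2 : area x y₂ y₃ * area z y₃ y₁ ≤ area x y₃ y₁ * area z y₂ y₃)
    (h3 : area x y₂ y₃ * area z y₁ y₂ ≤ area x y₁ y₂ * area z y₂ y₃)
    (ih : area z y₂ y₃ < area y₁ y₂ y₃ → InTriangle z y₂ y₃ x → defect u z y₂ y₃ x ≤ 0)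
    (hle : defect u y₁ y₂ y₃ z ≤ defect u y₁ y₂ y₃ x) (hF : 0 < defect u y₁ y₂ y₃ x) : z = x := by
  have i2 : area y₁ y₂ y₃ * area x y₃ z =
      area x y₃ y₁ * area z y₂ y₃ - area x y₂ y₃ * area z y₃ y₁ := by
    simp only [area, det, Prod.fst_sub, Prod.snd_sub]; ring
  have i3 : area y₁ y₂ y₃ * area x z y₂ =
      area x y₁ y₂ * area z y₂ y₃ - area x y₂ y₃ * area z y₁ y₂ := by
    simp only [area, det, Prod.fst_sub, Prod.snd_sub]; ring
  have hin : InTriangle z y₂ y₃ x := by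
    refine ⟨hx.fst, ?_, ?_⟩
    · by_contra hn
      nlinarith
    · by_contra hn
      nlinarith
  have hd := ih (hz.area_lt hD hzy) hin
  have hD' : (0 : ℝ) < area y₁ y₂ y₃ := by exact_mod_cast hD
  have key : area y₁ y₂ y₃ * defect u z y₂ y₃ x =
      area z y₂ y₃ * defect u y₁ y₂ y₃ x - area x y₂ y₃ * defect u y₁ y₂ y₃ z := by
    have i2' : (area y₁ y₂ y₃ : ℝ) * area x y₃ z =
      area x y₃ y₁ * area z y₂ y₃ - area x y₂ y₃ * area z y₃ y₁ := by exact_mod_cast i2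
    have i3' : (area y₁ y₂ y₃ : ℝ) * area x z y₂ =
      area x y₁ y₂ * area z y₂ y₃ - area x y₂ y₃ * area z y₁ y₂ := by exact_mod_cast i3
    simp only [defect]
    linear_combination (-u y₂) * i2' - u y₃ * i3'
  have hneg := mul_nonpos_of_nonneg_of_nonpos hD'.le hd
  rw [key] at hneg
  have hx1 : (0 : ℝ) ≤ area x y₂ y₃ := by exact_mod_cast hx.fst
  have hba : area z y₂ y₃ ≤ area x y₂ y₃ := by
    have : (area z y₂ y₃ : ℝ) ≤ area x y₂ y₃ := by
      refine le_of_mul_le_mul_right ?_ hF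
      linarith [mul_le_mul_of_nonneg_left hle hx1]
    exact_mod_cast this
  have c2 : area z y₃ y₁ ≤ area x y₃ y₁ :=
    le_of_mul_le_mul_right (by nlinarith [hz.snd]) hpos
  have c3 : area z y₁ y₂ ≤ area x y₁ y₂ :=
    le_of_mul_le_mul_right (by nlinarith [hz.trd]) hpos
  have s1 := area_add y₁ y₂ y₃ x
  have s2 := area_add y₁ y₂ y₃ z
  exact eq_of_area_eq hD (by omega) (by omega) (by omega)

/-- For barycentric coordinates a of x and b of z, the minimizing index is the vertex to replace by
z so that the triangle still contains x. -/
theorem exists_min_ratio {a b : Fin 3 → ℤ} (hb : ∀ i, 0 ≤ b i) (ha : ∀ i, 0 ≤ a i)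
    (hpos : ∃ i, 0 < b i) : ∃ i, 0 < b i ∧ ∀ j, a i * b j ≤ a j * b i := by
  obtain ⟨i, hi, hmin⟩ := Finset.exists_min_image (Finset.univ.filter fun i => 0 < b i)
    (fun i => (a i : ℚ) / b i) (by obtain ⟨i, hi⟩ := hpos; exact ⟨i, by simpa using hi⟩)
  have hi' : 0 < b i := by simpa using hi
  refine ⟨i, hi', fun j => ?_⟩
  rcases (hb j).lt_or_eq with hj | hj
  · have := hmin j (by simpa using hj)
    rw [div_le_div_iff₀ (by exact_mod_cast hi') (by exact_mod_cast hj)] at this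
    exact_mod_cast this
  · rw [← hj, mul_zero]
    exact mul_nonneg (ha j) (hb i)

/-- The point comes from `exists_lattice_point` in the subtriangle x, y₂, y₃; it differs from y₁
because its y₁-coordinate does not exceed that of x. -/
theorem exists_other_point (hG : LatticeConvex G) (h2 : y₂ ∈ G) (h3 : y₃ ∈ G)
    (hD : 0 < area y₁ y₂ y₃) (hxG : x ∈ G) (hx : InTriangle y₁ y₂ y₃ x) (hxy : x ≠ y₁)
    (ha : 2 ≤ area x y₂ y₃) :
    ∃ z ∈ G, InTriangle y₁ y₂ y₃ z ∧ z ≠ y₁ ∧ z ≠ y₂ ∧ z ≠ y₃ ∧ z ≠ x := by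
  obtain ⟨p, i, j, hi, hj, hij, hp, hp0, hp2, hp3⟩ := exists_lattice_point ha
  have hm : 0 < area x y₂ y₃ := by omega
  change i + j ≤ area x y₂ y₃ at hij
  change area x y₂ y₃ • p = _ at hp
  have p1 := congrArg Prod.fst hp
  have p2 := congrArg Prod.snd hp
  simp only [Prod.smul_fst, Prod.fst_sub, Prod.fst_add, smul_eq_mul, Prod.smul_snd, Prod.snd_sub,
    Prod.snd_add] at p1 p2
  have k1 : area x y₂ y₃ * area (x + p) y₂ y₃ = area x y₂ y₃ * (area x y₂ y₃ - i - j) := by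
    have : area (x + p) y₂ y₃ = area x y₂ y₃ - p.1 * (y₃.2 - y₂.2) + p.2 * (y₃.1 - y₂.1) := by
      simp only [area, det, Prod.fst_sub, Prod.snd_sub, Prod.fst_add, Prod.snd_add]; ring
    rw [this, mul_add, mul_sub, ← mul_assoc, ← mul_assoc, p1, p2]
    simp only [area, det, Prod.fst_sub, Prod.snd_sub]; ring
  have k2 : area x y₂ y₃ * area (x + p) y₃ y₁ =
      (area x y₂ y₃ - i - j) * area x y₃ y₁ + i * area y₁ y₂ y₃ := by
    have : area (x + p) y₃ y₁ = area x y₃ y₁ - p.1 * (y₁.2 - y₃.2) + p.2 * (y₁.1 - y₃.1) := by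
      simp only [area, det, Prod.fst_sub, Prod.snd_sub, Prod.fst_add, Prod.snd_add]; ring
    rw [this, mul_add, mul_sub, ← mul_assoc, ← mul_assoc, p1, p2]
    simp only [area, det, Prod.fst_sub, Prod.snd_sub]; ring
  have k3 : area x y₂ y₃ * area (x + p) y₁ y₂ =
      (area x y₂ y₃ - i - j) * area x y₁ y₂ + j * area y₁ y₂ y₃ := by
    have : area (x + p) y₁ y₂ = area x y₁ y₂ - p.1 * (y₂.2 - y₁.2) + p.2 * (y₂.1 - y₁.1) := by
      simp only [area, det, Prod.fst_sub, Prod.snd_sub, Prod.fst_add, Prod.snd_add]; ring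
    rw [this, mul_add, mul_sub, ← mul_assoc, ← mul_assoc, p1, p2]
    simp only [area, det, Prod.fst_sub, Prod.snd_sub]; ring
  have k1' := mul_left_cancel₀ hm.ne' k1
  refine ⟨x + p, hG.add_mem hxG (by simpa using h2) (by simpa using h3) hm hi hj hij hp,
    ⟨by omega, ?_, ?_⟩, ?_, ?_, ?_, by simpa using hp0⟩
  · refine nonneg_of_mul_nonneg_right (k2 ▸ ?_) hm
    exact add_nonneg (mul_nonneg (by omega) hx.snd) (mul_nonneg hi hD.le)
  · refine nonneg_of_mul_nonneg_right (k3 ▸ ?_) hm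
    exact add_nonneg (mul_nonneg (by omega) hx.trd) (mul_nonneg hj hD.le)
  · intro h
    have := hx.area_lt hD hxy
    rw [h] at k1'
    omega
  · intro h; exact hp2 (by rw [← h]; abel)
  · intro h; exact hp3 (by rw [← h]; abel)

/-- Here 2x = y₂ + y₃, so the defect is minus a segment form at x. -/
theorem defect_nonpos_of_midpoint
    (hseg : ∀ x ∈ G, ∀ e ∈ maxSet G x, x - e ∈ G → 0 ≤ u (x + e) - 2 * u x + u (x - e))
    (hx : x ∈ G) (h2 : y₂ ∈ G) (h3 : y₃ ∈ G) (a1 : area x y₂ y₃ = 0) (a2 : area x y₃ y₁ = 1)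
    (a3 : area x y₁ y₂ = 1) : defect u y₁ y₂ y₃ x ≤ 0 := by
  have hD := area_add y₁ y₂ y₃ x
  have hb := barycentric y₁ y₂ y₃ x
  rw [a1, a2, a3] at hD
  rw [← hD, a1, a2, a3] at hb
  have e2 : x + (y₂ - x) = y₂ := by abel
  have e3 : x - (y₂ - x) = y₃ := by
    have : x - (y₂ - x) = (0 + 1 + 1 : ℤ) • x - y₂ := by module
    rw [this, hb]; module
  have hs := hseg x hx (y₂ - x) ⟨irred_right_of_det_eq_one a3, by rwa [e2]⟩ (by rwa [e3])
  rw [e2, e3] at hs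
  rw [defect, ← hD, a1, a2, a3]
  push_cast
  linarith

/-- Here 3x = y₁ + y₂ + y₃, and y₃ - x has parents x - y₁ and x - y₂, so the defect is minus a
triangle form at x. -/
theorem defect_nonpos_of_centroid
    (htri : ∀ x ∈ G, ∀ e ∈ maxSet G x, ∀ f g, AreParents f g e → x - f ∈ G → x - g ∈ G →
      0 ≤ u (x + e) + u (x - f) + u (x - g) - 3 * u x)
    (hx : x ∈ G) (h1 : y₁ ∈ G) (h2 : y₂ ∈ G) (h3 : y₃ ∈ G) (a1 : area x y₂ y₃ = 1)
    (a2 : area x y₃ y₁ = 1) (a3 : area x y₁ y₂ = 1) (hdot : 0 ≤ dot (y₁ - x) (y₂ - x)) :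
    defect u y₁ y₂ y₃ x ≤ 0 := by
  have hD := area_add y₁ y₂ y₃ x
  have hb := barycentric y₁ y₂ y₃ x
  rw [a1, a2, a3] at hD
  rw [← hD, a1, a2, a3] at hb
  have e1 : x - -(y₁ - x) = y₁ := by abel
  have e2 : x - -(y₂ - x) = y₂ := by abel
  have e3 : x + (y₃ - x) = y₃ := by abel
  have hpar : AreParents (-(y₁ - x)) (-(y₂ - x)) (y₃ - x) := by
    refine ⟨?_, ?_, ?_⟩
    · rw [← a3]; simp only [area, det, Prod.fst_neg, Prod.snd_neg]; ring
    · simpa only [dot, Prod.fst_neg, Prod.snd_neg, neg_mul_neg] using hdot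
    · have : y₃ = (1 + 1 + 1 : ℤ) • x - y₁ - y₂ := by
        rw [hb]; module
      rw [this]; module
  have hs := htri x hx (y₃ - x) ⟨hpar.irred, by rwa [e3]⟩ _ _ hpar (by rwa [e1]) (by rwa [e2])
  rw [e1, e2, e3] at hs
  rw [defect, ← hD, a1, a2, a3]
  push_cast
  linarith

/-- Convexity on lattice triangles. -/
theorem defect_nonpos (hG : LatticeConvex G) (hfin : G.Finite)
    (hseg : ∀ x ∈ G, ∀ e ∈ maxSet G x, x - e ∈ G → 0 ≤ u (x + e) - 2 * u x + u (x - e))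
    (htri : ∀ x ∈ G, ∀ e ∈ maxSet G x, ∀ f g, AreParents f g e → x - f ∈ G → x - g ∈ G →
      0 ≤ u (x + e) + u (x - f) + u (x - g) - 3 * u x)
    (hy1 : y₁ ∈ G) (hy2 : y₂ ∈ G) (hy3 : y₃ ∈ G) (hD : 0 < area y₁ y₂ y₃)
    (hx : x ∈ G) (hin : InTriangle y₁ y₂ y₃ x) : defect u y₁ y₂ y₃ x ≤ 0 := by
  obtain ⟨n, hn⟩ : ∃ n : ℕ, area y₁ y₂ y₃ < n := ⟨(area y₁ y₂ y₃).toNat + 1, by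
    push_cast; have := Int.self_le_toNat (area y₁ y₂ y₃); omega⟩
  induction n generalizing y₁ y₂ y₃ x with
  | zero => push_cast at hn; omega
  | succ n ih =>
  push_cast at hn
  by_contra! hF
  set P : Set (ℤ × ℤ) := {z ∈ G | InTriangle y₁ y₂ y₃ z ∧ z ≠ y₁ ∧ z ≠ y₂ ∧ z ≠ y₃} with hP
  have hxP : x ∈ P := by
    refine ⟨hx, hin, ?_, ?_, ?_⟩ <;> rintro rfl
    · simp [defect, area_left_self, area_right_self] at hF
    · simp [defect, area_left_self, area_right_self] at hF
      simp [← area_rotate y₁] at hF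
    · simp [defect, area_left_self, area_right_self, area_rotate] at hF
  -- The defect vanishes at the vertices, so a violation occurs in P; t is a worst one.
  obtain ⟨t, htP, hmax⟩ := Set.exists_max_image P (defect u y₁ y₂ y₃)
    (hfin.subset (Set.sep_subset _ _)) ⟨x, hxP⟩
  have htF : 0 < defect u y₁ y₂ y₃ t := hF.trans_le (hmax x hxP)
  obtain ⟨htG, ht, ht1, ht2, ht3⟩ := htP
  have r1 : area y₂ y₃ y₁ = area y₁ y₂ y₃ := area_rotate _ _ _
  have r2 : area y₃ y₁ y₂ = area y₁ y₂ y₃ := by rw [area_rotate, area_rotate]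
  have f1 : defect u y₂ y₃ y₁ = defect u y₁ y₂ y₃ := funext fun s => defect_rotate u _ _ _ s
  have f2 : defect u y₃ y₁ y₂ = defect u y₁ y₂ y₃ :=
    funext fun s => by rw [defect_rotate, defect_rotate]
  have huniq : ∀ z ∈ P, z = t := by
    rintro z hzP
    obtain ⟨hzG, hz, hz1, hz2, hz3⟩ := id hzP
    have hle := hmax z hzP
    obtain ⟨i, hi, hmin⟩ := exists_min_ratio
      (a := ![area t y₂ y₃, area t y₃ y₁, area t y₁ y₂])
      (b := ![area z y₂ y₃, area z y₃ y₁, area z y₁ y₂])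
      (by intro i; fin_cases i; exacts [hz.fst, hz.snd, hz.trd])
      (by intro i; fin_cases i; exacts [ht.fst, ht.snd, ht.trd])
      (by
        by_contra! h
        have h1 := h 0
        have h2 := h 1
        have h3 := h 2
        have h4 := area_add y₁ y₂ y₃ z
        simp only [Matrix.cons_val] at h1 h2 h3
        omega)
    have m1 := hmin 0
    have m2 := hmin 1
    have m3 := hmin 2
    fin_cases i
    · exact eq_of_le_of_min_ratio hD ht hz hz1 hi m2 m3
        (fun hlt hi' => ih hzG hy2 hy3 hi htG hi' (by omega)) hle htF
    · exact eq_of_le_of_min_ratio (by rwa [r1]) ht.rotate hz.rotate hz2 hi m3 m1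
        (fun hlt hi' => ih hzG hy3 hy1 hi htG hi' (by omega)) (by rwa [f1]) (by rwa [f1])
    · exact eq_of_le_of_min_ratio (by rwa [r2]) ht.rotate.rotate hz.rotate.rotate hz3 hi m1 m2
        (fun hlt hi' => ih hzG hy1 hy2 hi htG hi' (by omega)) (by rwa [f2]) (by rwa [f2])
  -- As t is the only lattice point besides the vertices, no subtriangle at t has doubled area 2 or
  -- more. One zero area makes t a midpoint, none makes it the centroid.
  have l1 : area t y₂ y₃ ≤ 1 := by
    by_contra h
    obtain ⟨z, hz, hz', h1, h2, h3, hne⟩ := exists_other_point hG hy2 hy3 hD htG ht ht1 (by omega)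
    exact hne (huniq z ⟨hz, hz', h1, h2, h3⟩)
  have l2 : area t y₃ y₁ ≤ 1 := by
    by_contra h
    obtain ⟨z, hz, hz', h2, h3, h1, hne⟩ :=
      exists_other_point hG hy3 hy1 (by rwa [r1]) htG ht.rotate ht2 (by omega)
    exact hne (huniq z ⟨hz, hz'.rotate.rotate, h1, h2, h3⟩)
  have l3 : area t y₁ y₂ ≤ 1 := by
    by_contra h
    obtain ⟨z, hz, hz', h3, h1, h2, hne⟩ :=
      exists_other_point hG hy1 hy2 (by rwa [r2]) htG ht.rotate.rotate ht3 (by omega)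
    exact hne (huniq z ⟨hz, hz'.rotate, h1, h2, h3⟩)
  have n1 := ht.fst
  have n2 := ht.snd
  have n3 := ht.trd
  have hsum := area_add y₁ y₂ y₃ t
  have lt1 := ht.area_lt hD ht1
  have lt2 := ht.rotate.area_lt (by rwa [r1]) ht2
  have lt3 := ht.rotate.rotate.area_lt (by rwa [r2]) ht3
  rw [r1] at lt2
  rw [r2] at lt3
  by_cases z1 : area t y₂ y₃ = 0
  · exact htF.not_ge (defect_nonpos_of_midpoint hseg htG hy2 hy3 z1 (by omega) (by omega))
  by_cases z2 : area t y₃ y₁ = 0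
  · rw [← f1] at htF
    exact htF.not_ge (defect_nonpos_of_midpoint hseg htG hy3 hy1 z2 (by omega) (by omega))
  by_cases z3 : area t y₁ y₂ = 0
  · rw [← f2] at htF
    exact htF.not_ge (defect_nonpos_of_midpoint hseg htG hy1 hy2 z3 (by omega) (by omega))
  have a1 : area t y₂ y₃ = 1 := by omega
  have a2 : area t y₃ y₁ = 1 := by omega
  have a3 : area t y₁ y₂ = 1 := by omega
  by_cases d3 : 0 ≤ dot (y₁ - t) (y₂ - t)
  · exact htF.not_ge (defect_nonpos_of_centroid htri htG hy1 hy2 hy3 a1 a2 a3 d3)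
  by_cases d1 : 0 ≤ dot (y₂ - t) (y₃ - t)
  · rw [← f1] at htF
    exact htF.not_ge (defect_nonpos_of_centroid htri htG hy2 hy3 hy1 a2 a3 a1 d1)
  by_cases d2 : 0 ≤ dot (y₃ - t) (y₁ - t)
  · rw [← f2] at htF
    exact htF.not_ge (defect_nonpos_of_centroid htri htG hy3 hy1 hy2 a3 a1 a2 d2)
  -- The three vectors from t to the vertices sum to zero. If all pairwise products α, β, γ were
  -- negative, Lagrange's identity would give αβ + βγ + γα = 1, while the left side is at least 3.
  have hb := barycentric y₁ y₂ y₃ t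
  rw [← hsum, a1, a2, a3] at hb
  have hsum0 : (y₁ - t) = -(y₂ - t) - (y₃ - t) := by
    have : y₁ = (1 + 1 + 1 : ℤ) • t - y₂ - y₃ := by rw [hb]; module
    rw [this]; module
  have hl := lagrange_identity (y₁ - t) (y₂ - t)
  change _ = _ + area t y₁ y₂ ^ 2 at hl
  rw [a3] at hl
  have q1 : dot (y₁ - t) (y₁ - t) = -dot (y₁ - t) (y₂ - t) - dot (y₃ - t) (y₁ - t) := by
    nth_rewrite 2 [hsum0]
    simp only [dot, Prod.fst_sub, Prod.snd_sub, Prod.fst_neg, Prod.snd_neg]; ring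
  have q2 : dot (y₂ - t) (y₂ - t) = -dot (y₁ - t) (y₂ - t) - dot (y₂ - t) (y₃ - t) := by
    rw [hsum0]
    simp only [dot, Prod.fst_sub, Prod.snd_sub, Prod.fst_neg, Prod.snd_neg]; ring
  rw [q1, q2] at hl
  generalize dot (y₁ - t) (y₂ - t) = α at *
  generalize dot (y₂ - t) (y₃ - t) = β at *
  generalize dot (y₃ - t) (y₁ - t) = γ at *
  nlinarith [mul_pos (by omega : 0 < -α) (by omega : 0 < -β),
    mul_pos (by omega : 0 < -γ) (by omega : 0 < -β), mul_pos (by omega : 0 < -α) (by omega : 0 < -γ)]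

end

/-! ### Supporting affine functions by Helly's theorem. -/

section

variable {G : Set (ℤ × ℤ)} {x : ℤ × ℤ} {u : ℤ × ℤ → ℝ}

theorem exists_slope_of_parallel {E : Set (ℤ × ℤ)} (hfin : E.Finite) {c : ℤ × ℤ → ℝ}
    (h2 : ∀ v ∈ E, ∀ w ∈ E, det v w = 0 → dot v w < 0 → 0 ≤ -dot v w * c v + dot v v * c w)
    (h0 : ∀ v ∈ E, v ≠ 0) {e : ℤ × ℤ} (he : e ≠ 0) (hpar : ∀ v ∈ E, det e v = 0) :
    ∃ m : ℝ × ℝ, ∀ v ∈ E, m.1 * v.1 + m.2 * v.2 ≤ c v := by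
  have hn := dot_self_pos he
  obtain ⟨s, hs1, hs2⟩ := exists_between_of_finite
    (A := (fun v => c v / dot e v) '' {v ∈ E | dot e v < 0})
    (B := (fun v => c v / dot e v) '' {v ∈ E | 0 < dot e v})
    ((hfin.subset (Set.sep_subset _ _)).image _) ((hfin.subset (Set.sep_subset _ _)).image _) (by
      rintro _ ⟨v, ⟨hv, hve⟩, rfl⟩ _ ⟨w, ⟨hw, hwe⟩, rfl⟩
      have hvn := dot_self_pos (h0 v hv)
      have p1 := hpar v hv
      have p2 := hpar w hw
      have hdet : det v w = 0 := by
        have : dot e e * det v w = dot e v * det e w - dot e w * det e v := by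
          simp only [dot, det]; ring
        rw [p1, p2, mul_zero, mul_zero, sub_zero] at this
        exact (mul_eq_zero.1 this).resolve_left hn.ne'
      have hrel : dot v w * dot e v = dot v v * dot e w := by
        have : dot v w * dot e v - dot v v * dot e w = det v w * (e.1 * v.2 - e.2 * v.1) := by
          simp only [dot, det]; ring
        rw [hdet, zero_mul] at this
        linarith
      have hlt : dot v w < 0 := by
        have := mul_pos hvn hwe
        by_contra hcon
        have := mul_nonneg (not_lt.1 hcon) (neg_pos.2 hve).le
        linarith
      have h3 := h2 v hv w hw hdet hlt
      have hve' : (dot e v : ℝ) < 0 := by exact_mod_cast hve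
      have hwe' : (0 : ℝ) < dot e w := by exact_mod_cast hwe
      have hvn' : (0 : ℝ) < dot v v := by exact_mod_cast hvn
      have hrel' : (dot v w : ℝ) * dot e v = dot v v * dot e w := by exact_mod_cast hrel
      dsimp only
      rw [← neg_div_neg_eq, div_le_div_iff₀ (neg_pos.2 hve') hwe']
      refine le_of_mul_le_mul_left ?_ hvn'
      have h4 := mul_nonneg h3 (neg_pos.2 hve').le
      have h5 : (-(dot v w : ℝ) * c v + dot v v * c w) * -dot e v =
          dot v v * dot e w * c v - dot v v * c w * dot e v := by
        linear_combination c v * hrel'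
      linarith)
  refine ⟨(s * e.1, s * e.2), fun v hv => ?_⟩
  have hdot : s * e.1 * v.1 + s * e.2 * v.2 = s * dot e v := by
    simp only [dot]; push_cast; ring
  dsimp only
  rw [hdot]
  rcases lt_trichotomy (dot e v) 0 with h | h | h
  · have h' : (dot e v : ℝ) < 0 := by exact_mod_cast h
    exact (div_le_iff_of_neg h').1 (hs1 _ ⟨v, ⟨hv, h⟩, rfl⟩)
  · have := lagrange_identity e v
    rw [h, hpar v hv] at this
    have := mul_pos hn (dot_self_pos (h0 v hv))
    omega
  · have h' : (0 : ℝ) < dot e v := by exact_mod_cast h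
    exact (le_div_iff₀ h').1 (hs2 _ ⟨v, ⟨hv, h⟩, rfl⟩)

/-- A slope is determined by its values s, t on v₁, v₂, and its value on v₃ follows from det(v₂,
v₃)v₁ + det(v₃, v₁)v₂ + det(v₁, v₂)v₃ = 0. If one of the first two coefficients is negative,
lowering s or t meets the third constraint; otherwise `h3` is exactly the compatibility condition.
-/
theorem exists_slope_of_det_pos {c : ℤ × ℤ → ℝ} {v₁ v₂ v₃ : ℤ × ℤ} (hD : 0 < det v₁ v₂)
    (h3 : 0 ≤ det v₂ v₃ → 0 ≤ det v₃ v₁ →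
      0 ≤ det v₂ v₃ * c v₁ + det v₃ v₁ * c v₂ + det v₁ v₂ * c v₃) :
    ∃ m : ℝ × ℝ, m.1 * v₁.1 + m.2 * v₁.2 ≤ c v₁ ∧ m.1 * v₂.1 + m.2 * v₂.2 ≤ c v₂ ∧
      m.1 * v₃.1 + m.2 * v₃.2 ≤ c v₃ := by
  have hD' : (0 : ℝ) < det v₁ v₂ := by exact_mod_cast hD
  suffices h : ∃ s t : ℝ, s ≤ c v₁ ∧ t ≤ c v₂ ∧
      0 ≤ det v₂ v₃ * s + det v₃ v₁ * t + det v₁ v₂ * c v₃ by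
    obtain ⟨s, t, hs, ht, hst⟩ := h
    refine ⟨((s * v₂.2 - t * v₁.2) / det v₁ v₂, (t * v₁.1 - s * v₂.1) / det v₁ v₂), ?_, ?_, ?_⟩
    · convert hs using 1
      field_simp
      simp only [det]; push_cast; ring
    · convert ht using 1
      field_simp
      simp only [det]; push_cast; ring
    · have : (s * v₂.2 - t * v₁.2) / (det v₁ v₂ : ℝ) * v₃.1 +
          (t * v₁.1 - s * v₂.1) / (det v₁ v₂ : ℝ) * v₃.2 =
          -(det v₂ v₃ * s + det v₃ v₁ * t) / det v₁ v₂ := by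
        field_simp
        simp only [det]; push_cast; ring
      dsimp only
      rw [this, div_le_iff₀ hD']
      linarith
  rcases lt_or_ge (det v₂ v₃) 0 with hA | hA
  · have hA' : (det v₂ v₃ : ℝ) < 0 := by exact_mod_cast hA
    refine ⟨min (c v₁) (-(det v₃ v₁ * c v₂ + det v₁ v₂ * c v₃) / det v₂ v₃), c v₂,
      min_le_left _ _, le_rfl, ?_⟩
    have h := mul_le_mul_of_nonpos_left (min_le_right (c v₁)
      (-(det v₃ v₁ * c v₂ + det v₁ v₂ * c v₃) / det v₂ v₃)) hA'.le
    rw [mul_div_cancel₀ _ hA'.ne] at h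
    linarith
  rcases lt_or_ge (det v₃ v₁) 0 with hB | hB
  · have hB' : (det v₃ v₁ : ℝ) < 0 := by exact_mod_cast hB
    refine ⟨c v₁, min (c v₂) (-(det v₂ v₃ * c v₁ + det v₁ v₂ * c v₃) / det v₃ v₁),
      le_rfl, min_le_left _ _, ?_⟩
    have h := mul_le_mul_of_nonpos_left (min_le_right (c v₂)
      (-(det v₂ v₃ * c v₁ + det v₁ v₂ * c v₃) / det v₃ v₁)) hB'.le
    rw [mul_div_cancel₀ _ hB'.ne] at h
    linarith
  · exact ⟨c v₁, c v₂, le_rfl, le_rfl, h3 hA hB⟩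

theorem exists_slope_of_three {E : Set (ℤ × ℤ)} {c : ℤ × ℤ → ℝ}
    (h2 : ∀ v ∈ E, ∀ w ∈ E, det v w = 0 → dot v w < 0 → 0 ≤ -dot v w * c v + dot v v * c w)
    (h3 : ∀ v₁ ∈ E, ∀ v₂ ∈ E, ∀ v₃ ∈ E, 0 < det v₁ v₂ → 0 ≤ det v₂ v₃ → 0 ≤ det v₃ v₁ →
      0 ≤ det v₂ v₃ * c v₁ + det v₃ v₁ * c v₂ + det v₁ v₂ * c v₃)
    (h0 : ∀ v ∈ E, v ≠ 0) {v₁ v₂ v₃ : ℤ × ℤ} (hv₁ : v₁ ∈ E) (hv₂ : v₂ ∈ E) (hv₃ : v₃ ∈ E) :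
    ∃ m : ℝ × ℝ, m.1 * v₁.1 + m.2 * v₁.2 ≤ c v₁ ∧ m.1 * v₂.1 + m.2 * v₂.2 ≤ c v₂ ∧
      m.1 * v₃.1 + m.2 * v₃.2 ≤ c v₃ := by
  have hanti : ∀ v w : ℤ × ℤ, det w v = -det v w := by intro v w; simp only [det]; ring
  rcases lt_trichotomy (det v₁ v₂) 0 with h | h | h
  · obtain ⟨m, a, b, d⟩ := exists_slope_of_det_pos (c := c) (v₃ := v₃)
      (by rw [hanti]; omega : 0 < det v₂ v₁) (h3 _ hv₂ _ hv₁ _ hv₃ (by rw [hanti]; omega))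
    exact ⟨m, b, a, d⟩
  · rcases lt_trichotomy (det v₁ v₃) 0 with h' | h' | h'
    · obtain ⟨m, a, b, d⟩ := exists_slope_of_det_pos (c := c) (v₃ := v₂)
        (by rw [hanti]; omega : 0 < det v₃ v₁) (h3 _ hv₃ _ hv₁ _ hv₂ (by rw [hanti]; omega))
      exact ⟨m, b, d, a⟩
    · have hsub : ({v₁, v₂, v₃} : Set (ℤ × ℤ)) ⊆ E := by
        rintro v (rfl | rfl | rfl) <;> assumption
      obtain ⟨m, hm⟩ := exists_slope_of_parallel (E := {v₁, v₂, v₃}) (Set.toFinite _) (c := c)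
        (fun v hv w hw => h2 v (hsub hv) w (hsub hw)) (fun v hv => h0 v (hsub hv)) (h0 v₁ hv₁) (by
          rintro v (rfl | rfl | rfl)
          · simp only [det]; ring
          · exact h
          · exact h')
      exact ⟨m, hm _ (by simp), hm _ (by simp), hm _ (by simp)⟩
    · obtain ⟨m, a, b, d⟩ := exists_slope_of_det_pos (c := c) (v₃ := v₂)
        h' (h3 _ hv₁ _ hv₃ _ hv₂ h')
      exact ⟨m, a, d, b⟩
  · exact exists_slope_of_det_pos h (h3 _ hv₁ _ hv₂ _ hv₃ h)

/-- Each constraint is a half-plane of slopes, so by Helly's theorem in dimension 2 three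
constraints at a time suffice. -/
theorem exists_slope {E : Set (ℤ × ℤ)} (hfin : E.Finite) {c : ℤ × ℤ → ℝ}
    (h2 : ∀ v ∈ E, ∀ w ∈ E, det v w = 0 → dot v w < 0 → 0 ≤ -dot v w * c v + dot v v * c w)
    (h3 : ∀ v₁ ∈ E, ∀ v₂ ∈ E, ∀ v₃ ∈ E, 0 < det v₁ v₂ → 0 ≤ det v₂ v₃ → 0 ≤ det v₃ v₁ →
      0 ≤ det v₂ v₃ * c v₁ + det v₃ v₁ * c v₂ + det v₁ v₂ * c v₃)
    (h0 : ∀ v ∈ E, v ≠ 0) : ∃ m : ℝ × ℝ, ∀ v ∈ E, m.1 * v.1 + m.2 * v.2 ≤ c v := by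
  have hhelly := Convex.helly_theorem' (𝕜 := ℝ) (s := hfin.toFinset)
    (F := fun v => {m : ℝ × ℝ | m.1 * v.1 + m.2 * v.2 ≤ c v}) ?_ ?_
  · obtain ⟨m, hm⟩ := hhelly
    refine ⟨m, fun v hv => ?_⟩
    simp only [Set.mem_iInter] at hm
    exact hm v (by simpa using hv)
  · intro v _ m hm m' hm' a b ha hb hab
    simp only [Set.mem_ofPred_eq, Prod.fst_add, Prod.snd_add, Prod.smul_fst, Prod.smul_snd,
      smul_eq_mul] at *
    have h4 := mul_le_mul_of_nonneg_left hm ha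
    have h5 := mul_le_mul_of_nonneg_left hm' hb
    have h6 : c v = a * c v + b * c v := by rw [← add_mul, hab, one_mul]
    linarith
  · intro I hI hcard
    rw [Module.finrank_prod, Module.finrank_self] at hcard
    have hsub : ∀ v ∈ I, v ∈ E := fun v hv => by simpa using hI hv
    rcases I.eq_empty_or_nonempty with rfl | ⟨v₁, hv₁⟩
    · exact ⟨0, by simp⟩
    -- Subfamilies of fewer than three vectors are listed with repetitions.
    obtain ⟨v₂, hv₂, v₃, hv₃, hall⟩ :
        ∃ v₂ ∈ I, ∃ v₃ ∈ I, ∀ v ∈ I, v = v₁ ∨ v = v₂ ∨ v = v₃ := by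
      by_contra! hcon
      obtain ⟨a, ha, ha1, -, -⟩ := hcon v₁ hv₁ v₁ hv₁
      obtain ⟨b, hb, hb1, hb2, -⟩ := hcon a ha a ha
      obtain ⟨d, hd, hd1, hd2, hd3⟩ := hcon a ha b hb
      have : ({v₁, a, b, d} : Finset (ℤ × ℤ)).card ≤ I.card := by
        refine Finset.card_le_card ?_
        intro v hv
        simp only [Finset.mem_insert, Finset.mem_singleton] at hv
        rcases hv with rfl | rfl | rfl | rfl <;> assumption
      rw [Finset.card_insert_of_notMem (by simp [ha1.symm, hb1.symm, hd1.symm]),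
        Finset.card_insert_of_notMem (by simp [hb2.symm, hd2.symm]),
        Finset.card_insert_of_notMem (by simp [hd3.symm]), Finset.card_singleton] at this
      omega
    obtain ⟨m, hm1, hm2, hm3⟩ := exists_slope_of_three h2 h3 h0 (hsub _ hv₁) (hsub _ hv₂)
      (hsub _ hv₃)
    refine ⟨m, ?_⟩
    simp only [Set.mem_iInter]
    intro v hv
    rcases hall v hv with rfl | rfl | rfl <;> assumption

/-- At each lattice point, `u` has a supporting affine function. -/
theorem exists_support (hG : LatticeConvex G) (hfin : G.Finite)
    (hseg : ∀ x ∈ G, ∀ e ∈ maxSet G x, x - e ∈ G → 0 ≤ u (x + e) - 2 * u x + u (x - e))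
    (htri : ∀ x ∈ G, ∀ e ∈ maxSet G x, ∀ f g, AreParents f g e → x - f ∈ G → x - g ∈ G →
      0 ≤ u (x + e) + u (x - f) + u (x - g) - 3 * u x) (hx : x ∈ G) :
    ∃ m : ℝ × ℝ, ∀ y ∈ G, u x + (m.1 * (y.1 - x.1) + m.2 * (y.2 - x.2)) ≤ u y := by
  have hslope := exists_slope (E := {v | v ≠ 0 ∧ x + v ∈ G}) (c := fun v => u (x + v) - u x)
    ((hfin.preimage (f := fun v => x + v) (add_right_injective x).injOn).subset
      fun v hv => hv.2) ?_ ?_ (fun v hv => hv.1)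
  · obtain ⟨m, hm⟩ := hslope
    refine ⟨m, fun y hy => ?_⟩
    by_cases hyx : y = x
    · subst hyx; simp
    · have := hm (y - x) ⟨sub_ne_zero.2 hyx, by rwa [add_sub_cancel]⟩
      rw [add_sub_cancel] at this
      push_cast [Prod.fst_sub, Prod.snd_sub] at this
      linarith
  · rintro v ⟨-, hv⟩ w ⟨-, hw⟩ hdet hdot
    have := segment_convex hG hseg hx hv hw
    simp only [add_sub_cancel_left] at this
    exact this hdet hdot
  · rintro v₁ ⟨-, hv₁⟩ v₂ ⟨-, hv₂⟩ v₃ ⟨-, hv₃⟩ d3 d1 d2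
    have a1 : area x (x + v₂) (x + v₃) = det v₂ v₃ := by simp [area]
    have a2 : area x (x + v₃) (x + v₁) = det v₃ v₁ := by simp [area]
    have a3 : area x (x + v₁) (x + v₂) = det v₁ v₂ := by simp [area]
    have hsum := area_add (x + v₁) (x + v₂) (x + v₃) x
    have hd := defect_nonpos hG hfin hseg htri hv₁ hv₂ hv₃ (by omega) hx
      ⟨by omega, by omega, by omega⟩
    rw [defect, ← hsum, a1, a2, a3] at hd
    push_cast at hd
    linarith

end

/-! ### Stencil families on the grid and the convex extension. -/

section

theorem finite_grid {Ω : Set (ℝ × ℝ)} (h : IsCompact Ω) : (grid Ω).Finite := by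
  obtain ⟨R, hR⟩ := h.isBounded.subset_closedBall 0
  obtain ⟨N, hN⟩ := exists_nat_ge R
  refine (Set.finite_Icc ((-N : ℤ), (-N : ℤ)) ((N : ℤ), (N : ℤ))).subset fun p hp => ?_
  have h1 := hR hp
  rw [mem_closedBall_zero_iff, Prod.norm_def, sup_le_iff, Real.norm_eq_abs, Real.norm_eq_abs,
    abs_le, abs_le] at h1
  simp only [toPlane] at h1
  have b1 : (-N : ℝ) ≤ p.1 := by linarith [h1.1.1]
  have b2 : (p.1 : ℝ) ≤ N := by linarith [h1.1.2]
  have b3 : (-N : ℝ) ≤ p.2 := by linarith [h1.2.1]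
  have b4 : (p.2 : ℝ) ≤ N := by linarith [h1.2.2]
  exact ⟨⟨by exact_mod_cast b1, by exact_mod_cast b3⟩, ⟨by exact_mod_cast b2, by exact_mod_cast b4⟩⟩

variable {Ω : Set (ℝ × ℝ)} {V V' : grid Ω → Set (ℤ × ℤ)}

theorem finite_maxStencil (h : IsCompact Ω) (x : grid Ω) : (maxStencil x).Finite :=
  ((finite_grid h).preimage (f := fun v => (x : ℤ × ℤ) + v) (add_right_injective _).injOn).subset
    fun _ hv => hv.2

theorem IsStencilFamily.union (hV : IsStencilFamily V) (hV' : IsStencilFamily V') :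
    IsStencilFamily fun x => V x ∪ V' x where
  subset_max x := Set.union_subset (hV.subset_max x) (hV'.subset_max x)
  stability x e he f hf hfe := he.imp (fun h => hV.stability x e h f hf hfe)
    (fun h => hV'.stability x e h f hf hfe)
  visibility x := by
    refine le_antisymm (Submodule.span_mono (Set.image_mono
      (Set.union_subset (hV.subset_max x) (hV'.subset_max x)))) ?_
    rw [← hV.visibility x]
    exact Submodule.span_mono (Set.image_mono Set.subset_union_left)

theorem IsStencilFamily.inter (hconv : Convex ℝ Ω) (hcomp : IsCompact Ω)
    (hV : IsStencilFamily V) (hV' : IsStencilFamily V') :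
    IsStencilFamily fun x => V x ∩ V' x where
  subset_max x := Set.inter_subset_left.trans (hV.subset_max x)
  stability x e he f hf hfe := ⟨hV.stability x e he.1 f hf hfe, hV'.stability x e he.2 f hf hfe⟩
  visibility x := by
    refine le_antisymm (Submodule.span_mono (Set.image_mono
      (Set.inter_subset_left.trans (hV.subset_max x)))) ?_
    refine Submodule.span_le.2 ?_
    rintro _ ⟨e, he, rfl⟩
    -- Induction on ‖e‖²: a vector missing from one of the families is a positive combination of two
    -- shorter vectors of the maximal stencil.
    obtain ⟨n, hn⟩ : ∃ n : ℕ, dot e e < n := ⟨(dot e e).toNat + 1, by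
      push_cast; have := Int.self_le_toNat (dot e e); omega⟩
    induction n generalizing e with
    | zero => have := dot_self_nonneg e; push_cast at hn; omega
    | succ n ih =>
      push_cast at hn
      have key : ∀ W : grid Ω → Set (ℤ × ℤ), IsStencilFamily W → e ∉ W x →
          toPlane e ∈ coneHull (V x ∩ V' x) := by
        intro W hW heW
        obtain ⟨p, hp, q, hq, hpq, hdot, -, -, a, b, ha, hb, hcomb⟩ :=
          exists_candidate (latticeConvex_grid hconv) x.2
            ((finite_maxStencil hcomp x).subset (hW.subset_max x)) (hW.subset_max x)
            (hW.stability x) (hW.visibility x) he heW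
        have h1 := dot_left_lt hdot (irred_right_of_det_eq_one hpq) ha hb
        have h2 := dot_right_lt hdot (irred_left_of_det_eq_one hpq) ha hb
        rw [← hcomb] at h1 h2
        have hpc := ih p (hW.subset_max x hp) (by omega)
        have hqc := ih q (hW.subset_max x hq) (by omega)
        have ha' : (0 : ℝ) ≤ a := by exact_mod_cast ha.le
        have hb' : (0 : ℝ) ≤ b := by exact_mod_cast hb.le
        have heq : toPlane e = (⟨a, ha'⟩ : {r : ℝ // 0 ≤ r}) • toPlane p
            + (⟨b, hb'⟩ : {r : ℝ // 0 ≤ r}) • toPlane q := by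
          rw [hcomb]
          ext <;> simp [toPlane]
        rw [heq]
        exact Submodule.add_mem _ (Submodule.smul_mem _ _ hpc) (Submodule.smul_mem _ _ hqc)
      by_cases h1 : e ∈ V x
      · by_cases h2 : e ∈ V' x
        · exact PointedCone.subset_hull ⟨e, ⟨h1, h2⟩, rfl⟩
        · exact key V' hV' h2
      · exact key V hV h1

theorem MemStencilCone.inter {u : grid Ω → ℝ} (h : MemStencilCone V u) (h' : MemStencilCone V' u) :
    MemStencilCone (fun x => V x ∩ V' x) u where
  segment x e he := h.segment x e he.1
  triangle x e he := h.triangle x e he.1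
  parallelogram x e he := by
    obtain ⟨hmax, hnot, f, g, hfg, hf, hg⟩ := he
    by_cases heV : e ∈ V x
    · exact h'.parallelogram x e ⟨hmax, fun heV' => hnot ⟨heV, heV'⟩, f, g, hfg, hf.2, hg.2⟩
    · exact h.parallelogram x e ⟨hmax, heV, f, g, hfg, hf.1, hg.1⟩

/-- Extension by zero of a function on the grid. -/
noncomputable def extend (u : grid Ω → ℝ) (p : ℤ × ℤ) : ℝ :=
  open Classical in if h : p ∈ grid Ω then u ⟨p, h⟩ else 0

theorem extend_of_mem (u : grid Ω → ℝ) {p : ℤ × ℤ} (h : p ∈ grid Ω) : extend u p = u ⟨p, h⟩ :=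
  dif_pos h

/-- Transfers the result on subsets of ℤ² to functions on the grid; stencils are extended by the
empty set and u by zero, and only values on the grid matter. -/
theorem MemStencilCone.forms_nonneg (hconv : Convex ℝ Ω) (hcomp : IsCompact Ω)
    (hV : IsStencilFamily V) {u : grid Ω → ℝ} (hu : MemStencilCone V u)
    (x : grid Ω) {e : ℤ × ℤ} (he : e ∈ maxSet (grid Ω) x) :
    (x - e ∈ grid Ω → 0 ≤ extend u (x + e) - 2 * extend u x + extend u (x - e)) ∧
    (∀ f g, AreParents f g e → x - f ∈ grid Ω → x - g ∈ grid Ω →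
      0 ≤ extend u (x + e) + extend u (x - f) + extend u (x - g) - 3 * extend u x) ∧
    (e ∉ V x → ∃ f g, AreParents f g e ∧ x + f ∈ grid Ω ∧ x + g ∈ grid Ω ∧
      0 ≤ extend u (x + e) - extend u (x + f) - extend u (x + g) + extend u x) := by
  have hS : ∀ {y : ℤ × ℤ} (hy : y ∈ grid Ω), {e | ∃ h : y ∈ grid Ω, e ∈ V ⟨y, h⟩} = V ⟨y, hy⟩ := by
    intro y hy; ext e; exact ⟨fun ⟨_, h⟩ => h, fun h => ⟨hy, h⟩⟩
  have := StencilCone.forms_nonneg (latticeConvex_grid hconv)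
    (S := fun y => {e | ∃ h : y ∈ grid Ω, e ∈ V ⟨y, h⟩}) (u := extend u) ?_ ?_ ?_ ?_ ?_ ?_ ?_ x.2 he
  · rwa [hS x.2] at this
  · intro y hy
    rw [hS hy]
    exact (finite_maxStencil hcomp ⟨y, hy⟩).subset (hV.subset_max _)
  · intro y hy
    rw [hS hy]
    exact hV.subset_max ⟨y, hy⟩
  · intro y hy
    rw [hS hy]
    exact hV.stability ⟨y, hy⟩
  · intro y hy
    rw [hS hy]
    exact hV.visibility ⟨y, hy⟩
  · rintro y hy e ⟨_, he⟩ hm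
    have hp := (hV.subset_max _ he).2
    rw [extend_of_mem u hy, extend_of_mem u hm, extend_of_mem u hp]
    exact hu.segment ⟨y, hy⟩ e he hp hm
  · rintro y hy e ⟨_, he⟩ f g hfg hf hg
    have hp := (hV.subset_max _ he).2
    rw [extend_of_mem u hy, extend_of_mem u hf, extend_of_mem u hg, extend_of_mem u hp]
    refine hu.triangle ⟨y, hy⟩ e he ?_ f g hfg hp hf hg
    -- A vector with parents is longer than them, hence has norm greater than 1.
    have h1 := hfg.dot_left_lt
    have h2 := (irred_left_of_det_eq_one hfg.direct).dot_self_pos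
    omega
  · rintro y hy e he hnot f ⟨_, hf⟩ g ⟨_, hg⟩ hfg
    have hpf := (hV.subset_max _ hf).2
    have hpg := (hV.subset_max _ hg).2
    rw [extend_of_mem u hy, extend_of_mem u he.2, extend_of_mem u hpf, extend_of_mem u hpg]
    exact hu.parallelogram ⟨y, hy⟩ e ⟨he, fun h => hnot ⟨hy, h⟩, f, g, hfg, hf, hg⟩ f g hfg he.2
      hpf hpg

theorem MemStencilCone.mono (hconv : Convex ℝ Ω) (hcomp : IsCompact Ω)
    (hV : IsStencilFamily V) (hV' : IsStencilFamily V') (hsub : ∀ x, V x ⊆ V' x)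
    {u : grid Ω → ℝ} (hu : MemStencilCone V u) : MemStencilCone V' u where
  segment x e he hp hm := by
    have := (hu.forms_nonneg hconv hcomp hV x (hV'.subset_max x he)).1 hm
    rwa [extend_of_mem u hp, extend_of_mem u hm, extend_of_mem u x.2] at this
  triangle x e he _ f g hfg hp hf hg := by
    have := (hu.forms_nonneg hconv hcomp hV x (hV'.subset_max x he)).2.1 f g hfg hf hg
    rwa [extend_of_mem u hp, extend_of_mem u hf, extend_of_mem u hg, extend_of_mem u x.2] at this
  parallelogram x e he f g hfg hp hf hg := by
    obtain ⟨f', g', hfg', -, -, h⟩ := (hu.forms_nonneg hconv hcomp hV x he.1).2.2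
      (fun h => he.2.1 (hsub x h))
    obtain ⟨rfl, rfl⟩ := hfg.unique hfg'
    rwa [extend_of_mem u hp, extend_of_mem u hf, extend_of_mem u hg, extend_of_mem u x.2] at h

theorem stencilCone_subset_convexCone (hconv : Convex ℝ Ω) (hcomp : IsCompact Ω)
    (hV : IsStencilFamily V) : stencilCone V ⊆ convexCone Ω := by
  intro u hu
  have hsupp : ∀ x : grid Ω, ∃ m : ℝ × ℝ, ∀ y : grid Ω,
      u x + (m.1 * ((y : ℤ × ℤ).1 - (x : ℤ × ℤ).1) + m.2 * ((y : ℤ × ℤ).2 - (x : ℤ × ℤ).2))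
        ≤ u y := by
    intro x
    obtain ⟨m, hm⟩ := exists_support (u := extend u) (latticeConvex_grid hconv) (finite_grid hcomp)
      (fun y hy e he => (MemStencilCone.forms_nonneg hconv hcomp hV hu ⟨y, hy⟩ he).1)
      (fun y hy e he => (MemStencilCone.forms_nonneg hconv hcomp hV hu ⟨y, hy⟩ he).2.1) x.2
    refine ⟨m, fun y => ?_⟩
    have := hm y y.2
    rwa [extend_of_mem u x.2, extend_of_mem u y.2] at this
  choose m hm using hsupp
  have : Finite (grid Ω) := finite_grid hcomp
  have := Fintype.ofFinite (grid Ω)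
  rcases isEmpty_or_nonempty (grid Ω) with hemp | hne
  -- The maximum of affine functions below requires a nonempty grid.
  · exact ⟨0, convexOn_const 0 hconv, fun x => hemp.elim x⟩
  let ℓ : grid Ω → ℝ × ℝ → ℝ := fun x p =>
    u x + ((m x).1 * (p.1 - (x : ℤ × ℤ).1) + (m x).2 * (p.2 - (x : ℤ × ℤ).2))
  have hle : ∀ x p, ℓ x p ≤ Finset.univ.sup' Finset.univ_nonempty (fun x => ℓ x p) :=
    fun x p => Finset.le_sup' (fun x => ℓ x p) (Finset.mem_univ x)
  refine ⟨fun p => Finset.univ.sup' Finset.univ_nonempty fun x => ℓ x p, ⟨hconv, ?_⟩, fun x => ?_⟩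
  · intro p _ q _ a b ha hb hab
    refine Finset.sup'_le _ _ fun x _ => ?_
    have h1 : ℓ x (a • p + b • q) = a * ℓ x p + b * ℓ x q := by
      obtain rfl : b = 1 - a := by linarith
      simp only [ℓ, Prod.fst_add, Prod.snd_add, Prod.smul_fst, Prod.smul_snd, smul_eq_mul]
      ring
    rw [h1]
    exact add_le_add (mul_le_mul_of_nonneg_left (hle x p) ha)
      (mul_le_mul_of_nonneg_left (hle x q) hb)
  · refine le_antisymm ?_ (Finset.sup'_le _ _ fun y _ => hm y x)
    refine le_trans (le_of_eq ?_) (hle x (toPlane x))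
    simp [ℓ, toPlane]

end

end StencilCone

theorem mainTheorem2 (Ω : Set (ℝ × ℝ)) (hconv : Convex ℝ Ω) (hcomp : IsCompact Ω)
    (V V' : StencilCone.grid Ω → Set (ℤ × ℤ))
    (hV : StencilCone.IsStencilFamily V) (hV' : StencilCone.IsStencilFamily V') :
    StencilCone.IsStencilFamily (fun x => V x ∪ V' x) ∧
    StencilCone.IsStencilFamily (fun x => V x ∩ V' x) ∧
    StencilCone.stencilCone (fun x => V x ∩ V' x) =
      StencilCone.stencilCone V ∩ StencilCone.stencilCone V' ∧
    StencilCone.stencilCone V ∪ StencilCone.stencilCone V' ⊆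
      StencilCone.stencilCone (fun x => V x ∪ V' x) ∧
    ((∀ x, V x ⊆ V' x) →
      StencilCone.stencilCone V ⊆ StencilCone.stencilCone V' ∧
      StencilCone.stencilCone V' ⊆ StencilCone.convexCone Ω) := by
  have hU := hV.union hV'
  have hI := hV.inter hconv hcomp hV'
  refine ⟨hU, hI, Set.Subset.antisymm (fun u hu => ⟨?_, ?_⟩) (fun u hu => hu.1.inter hu.2),
    Set.union_subset (fun u hu => ?_) (fun u hu => ?_), fun hsub => ⟨fun u hu => ?_, ?_⟩⟩
  · exact StencilCone.MemStencilCone.mono hconv hcomp hI hV (fun _ => Set.inter_subset_left) hu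
  · exact StencilCone.MemStencilCone.mono hconv hcomp hI hV' (fun _ => Set.inter_subset_right) hu
  · exact StencilCone.MemStencilCone.mono hconv hcomp hV hU (fun _ => Set.subset_union_left) hu
  · exact StencilCone.MemStencilCone.mono hconv hcomp hV' hU (fun _ => Set.subset_union_right) hu
  · exact StencilCone.MemStencilCone.mono hconv hcomp hV hV' hsub hu
  · exact StencilCone.stencilCone_subset_convexCone hconv hcomp hV'
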